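/- For $k\in\mathbb R^3$ write $\langle k\rangle=\sqrt{1+|k|^2}$, and let $\langle k\rangle^{-M}L^\infty$ be the space of measurable $f:\mathbb R^3\to\mathbb R$ with $\|f\|_M:=\|\langle k\rangle^{M}f\|_{L^\infty(\mathbb R^3)}<\infty$. Consider the kinetic wave equation $\partial_t f=\mathcal C[f]$ on $\mathbb R^3$ with $$\mathcal C[f](k_1)=\int_{\mathbb R^9}\big(|k_1||k_2||k_3||k_4|\big)^{2\beta}\big(f_2f_3f_4+f_1f_3f_4-f_1f_2f_4-f_1f_2f_3\big)\,\delta(k_1+k_2-k_3-k_4)\,\delta\big(|k_1|^2+|k_2|^2-|k_3|^2-|k_4|^2\big)\,dk_2\,dk_3\,dk_4,$$ where $f_i=f(k_i)$; that is, $$\mathcal C[f](k_1)=\frac18\int_{\mathbb R^3\times\mathbb S^2}\big(|k_1||k_2||k_3||k_4|\big)^{2\beta}\,|k_1-k_2|\,\big(f_2f_3f_4+f_1f_3f_4-f_1f_2f_4-f_1f_2f_3\big)\,dk_2\,d\sigma,$$ with $k_3=\frac{k_1+k_2}2+\frac{|k_1-k_2|}2\sigma$ and $k_4=\frac{k_1+k_2}2-\frac{|k_1-k_2|}2\sigma$.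 For $T>0$, a strong solution on $[0,T]$ with initial datum $f_0\in\langle k\rangle^{-M}L^\infty$ is a function $f\in C([0,T];\langle k\rangle^{-M}L^\infty)$ such that, for every $t\in[0,T]$, $f(t)=f_0+\int_0^t\mathcal C[f(s)]\,ds$ almost everywhere. **Theorem.** Let $\frac14<\beta\le1$ and $M>10$. Then the equation is ill-posed in $\langle k\rangle^{-M}L^\infty$, regardless of the size of the datum: for every $\delta>0$ there is $f_0$ with $\|f_0\|_M=\delta$ such that, for no $T>0$, there is a strong solution on $[0,T]$ with initial datum $f_0$. More precisely, for $A>0$ and $N\in\mathbb N$ let $$f^{0}_{A,N}(k)=\frac{A+\cos(N|k|^2)}{(1+|k|^4)^{M/4}}.$$ There are $c>0$, $A_0>0$ and $N_0\ge1$, depending only on $\beta$ and $M$, such that for all real $A\ge A_0$ and all integers $N\ge N_0$: 1. $f^0_{A,N}\in\langle k\rangle^{-M}L^\infty$; 2. there is $B_0\in\mathbb N$ such that, for all integers $B\ge B_0$ and all $k\in\mathbb R^3$ with $|k|^2=\omega:=2\pi B/N$, one has $\big|\mathcal C[f^0_{A,N}](k)\big|\ge c\,A^2\,\omega^{2\beta-\frac12-\frac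 M2}$; 3. for every $r>0$ and every $T>0$ there is no strong solution on $[0,T]$ with initial datum $r f^0_{A,N}$. -/

import Mathlib

open MeasureTheory Filter Topology

noncomputable section

namespace KineticWave

/-- Wave vectors, with the Euclidean norm. -/
abbrev Wave : Type := EuclideanSpace ℝ (Fin 3)

/-- The unit sphere of wave vector space. -/
abbrev Sph : Type := Metric.sphere (0 : Wave) 1

/-- The surface measure of the unit sphere (of total mass `4 * π`). -/
def surface : Measure Sph := (volume : Measure Wave).toSphere

/-- The japanese bracket. -/
def bracket (k : Wave) : ℝ := Real.sqrt (1 + ‖k‖ ^ 2)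

/-- The weighted essential supremum norm. -/
def wNorm (M : ℝ) (f : Wave → ℝ) : ENNReal :=
  eLpNorm (fun k => bracket k ^ M * f k) ⊤ volume

/-- `f` is a representative of an element of the weighted `L^∞` space. -/
def MemW (M : ℝ) (f : Wave → ℝ) : Prop :=
  MemLp (fun k => bracket k ^ M * f k) ⊤ volume

/-- First outgoing wave vector. -/
def out₁ (k₁ k₂ : Wave) (σ : Sph) : Wave :=
  (1 / 2 : ℝ) • (k₁ + k₂) + (‖k₁ - k₂‖ / 2) • (σ : Wave)

/-- Second outgoing wave vector. -/
def out₂ (k₁ k₂ : Wave) (σ : Sph) : Wave :=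
  (1 / 2 : ℝ) • (k₁ + k₂) - (‖k₁ - k₂‖ / 2) • (σ : Wave)

/-- Gain minus loss: `f₁ f₂ f₃ f₄ (1/f₁ + 1/f₂ - 1/f₃ - 1/f₄)`, written as the polynomial it is. -/
def gainLoss (f₁ f₂ f₃ f₄ : ℝ) : ℝ :=
  f₂ * f₃ * f₄ + f₁ * f₃ * f₄ - f₁ * f₂ * f₄ - f₁ * f₂ * f₃

/-- The collision operator. For fixed `k₁` and `k₂`, the solutions `(k₃, k₄)` of
`k₃ + k₄ = k₁ + k₂`, `|k₃|² + |k₄|² = |k₁|² + |k₂|²` are `(out₁ k₁ k₂ σ, out₂ k₁ k₂ σ)` with `σ` on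
the unit sphere. The measure `δ(k₁ + k₂ - k₃ - k₄) δ(|k₁|² + |k₂|² - |k₃|² - |k₄|²) dk₃ dk₄` is
`|k₁ - k₂| / 8 dσ`: put `k₃ = (k₁ + k₂) / 2 + r σ`, so that `dk₃ = r² dr dσ`, and the argument of
the second `δ` is `|k₁ - k₂|² / 2 - 2 r²`, with derivative `-4 r` in `r`. -/
def collision (β : ℝ) (f : Wave → ℝ) (k₁ : Wave) : ℝ :=
  (1 / 8) * ∫ p : Wave × Sph,
    (‖k₁‖ * ‖p.1‖ * ‖out₁ k₁ p.1 p.2‖ * ‖out₂ k₁ p.1 p.2‖) ^ (2 * β) * ‖k₁ - p.1‖ *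
      gainLoss (f k₁) (f p.1) (f (out₁ k₁ p.1 p.2)) (f (out₂ k₁ p.1 p.2))
    ∂((volume : Measure Wave).prod surface)

/-- `f` is a strong solution on `[0, T]` of the kinetic wave equation with datum `f₀`: a continuous
curve in the weighted `L^∞` space that satisfies Duhamel's formula. The curve of classes is given
through a representative that is measurable in time and wave vector together (every continuous
curve has one, and any two of them agree almost everywhere in time and wave vector), so that the
time integral has a meaning for almost every wave vector. -/
structure IsStrongSolution (β M T : ℝ) (f₀ : Wave → ℝ) (f : ℝ → Wave → ℝ) : Prop where
  measurable : Measurable (Function.uncurry f)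
  mem : ∀ t ∈ Set.Icc 0 T, MemW M (f t)
  continuous : ∀ t ∈ Set.Icc 0 T,
    Tendsto (fun s => wNorm M (fun k => f s k - f t k)) (𝓝[Set.Icc 0 T] t) (𝓝 0)
  duhamel : ∀ t ∈ Set.Icc 0 T, ∀ᵐ k : Wave,
    IntervalIntegrable (fun s => collision β (f s) k) volume 0 t ∧
      f t k = f₀ k + ∫ s in (0 : ℝ)..t, collision β (f s) k

/-- The oscillating datum. -/
def datum (M A : ℝ) (N : ℕ) (k : Wave) : ℝ :=
  (A + Real.cos (N * ‖k‖ ^ 2)) / (1 + ‖k‖ ^ 4) ^ (M / 4)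

end KineticWave

end

/-!
The collision operator loses the weight `⟨k⟩^(4β-1)`: it is locally Lipschitz from `⟨k⟩^(-M) L^∞`
into `⟨k⟩^(4β-1-M) L^∞`, and not better. By Duhamel's formula on a short time interval, on which the
solution hardly moves, the existence of a strong solution with datum `f₀` forces
`|C[f₀]| ≤ c ⟨k⟩^(4β-1-M) + O(⟨k⟩^(-M))` almost everywhere, for every `c > 0`.

The oscillating datum violates this near the spheres on which `cos (N |k|²) = 1`. The dangerous
interactions are those of a large `k₁` with `k₂` and `k₄` of order one. There the collision balance
is `f₂ f₄ (f₃ - f₁)` up to lower order terms, and the difference `f₃ - f₁` does not decay relative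
to `f₁`: as `k₁` sits at a crest of the cosine, it is about `-(1 - cos (N |k₃|²)) ⟨k₁⟩^(-M)`. By
Archimedes' theorem `|k₃|²` is uniformly distributed on an interval when `σ` is uniform on the
sphere, so `1 - cos (N |k₃|²)` has an average bounded below, and these interactions contribute
`-c A² |k₁|^(4β-1-M)`. What is left is smaller by a factor `η + A ⟨k₁⟩^(-2)`, where `η` bounds
`1 - cos (N |k₁|²)`.
-/

noncomputable section

namespace KineticWave

open scoped Real ENNReal

lemma lintegral_comp_normalize_mul_comp_norm {E : Type*} [NormedAddCommGroup E] [NormedSpace ℝ E]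
    [FiniteDimensional ℝ E] [Nontrivial E] [MeasurableSpace E] [BorelSpace E] (μ : Measure E)
    [μ.IsAddHaarMeasure] {φ : E → ℝ≥0∞} (hφ : Measurable φ) {g : ℝ → ℝ≥0∞} (hg : Measurable g) :
    ∫⁻ x, φ (‖x‖⁻¹ • x) * g ‖x‖ ∂μ =
      (∫⁻ σ : Metric.sphere (0 : E) 1, φ σ ∂μ.toSphere) *
        ∫⁻ ρ in Set.Ioi (0 : ℝ), ENNReal.ofReal (ρ ^ (Module.finrank ℝ E - 1)) * g ρ := by
  have hφ' : Measurable fun σ : Metric.sphere (0 : E) 1 => φ σ := by fun_prop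
  have hg' : Measurable fun ρ : Set.Ioi (0 : ℝ) => g ρ := by fun_prop
  have radial : ∫⁻ ρ : Set.Ioi (0 : ℝ), g ρ ∂Measure.volumeIoiPow (Module.finrank ℝ E - 1) =
      ∫⁻ ρ in Set.Ioi (0 : ℝ), ENNReal.ofReal (ρ ^ (Module.finrank ℝ E - 1)) * g ρ := by
    rw [Measure.volumeIoiPow, lintegral_withDensity_eq_lintegral_mul _ (by fun_prop) hg']
    exact lintegral_subtype_comap measurableSet_Ioi
      fun ρ => ENNReal.ofReal (ρ ^ (Module.finrank ℝ E - 1)) * g ρ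
  rw [← radial, ← lintegral_prod_mul hφ'.aemeasurable hg'.aemeasurable,
    ← μ.measurePreserving_homeomorphUnitSphereProd.lintegral_comp (by fun_prop)]
  conv_lhs => rw [← restrict_compl_singleton (μ := μ) (0 : E)]
  simp only [homeomorphUnitSphereProd_apply_fst_coe, homeomorphUnitSphereProd_apply_snd_coe]
  exact (lintegral_subtype_comap (measurableSet_singleton (0 : E)).compl
    fun x => φ (‖x‖⁻¹ • x) * g ‖x‖).symm

lemma lintegral_comp_sqrt_sq_add_sq {g : ℝ → ℝ≥0∞} (hg : Measurable g) :
    ∫⁻ y : ℝ × ℝ, g √(y.1 ^ 2 + y.2 ^ 2) =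
      ENNReal.ofReal (2 * π) * ∫⁻ r in Set.Ioi (0 : ℝ), ENNReal.ofReal r * g r := by
  have polar : ∀ p ∈ polarCoord.target, ENNReal.ofReal p.1 •
      g √((polarCoord.symm p).1 ^ 2 + (polarCoord.symm p).2 ^ 2) = ENNReal.ofReal p.1 * g p.1 := by
    rintro ⟨r, θ⟩ ⟨hr, -⟩
    have hsq : (r * Real.cos θ) ^ 2 + (r * Real.sin θ) ^ 2 = r ^ 2 := by
      linear_combination r ^ 2 * Real.cos_sq_add_sin_sq θ
    rw [polarCoord_symm_apply, hsq, Real.sqrt_sq (Set.mem_Ioi.1 hr).le, smul_eq_mul]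
  rw [← lintegral_comp_polarCoord_symm,
    setLIntegral_congr_fun polarCoord.open_target.measurableSet polar, polarCoord_target,
    Measure.volume_eq_prod, ← Measure.prod_restrict, lintegral_prod _ (by fun_prop)]
  simp only [lintegral_const, Measure.restrict_apply MeasurableSet.univ, Set.univ_inter,
    Real.volume_Ioo]
  rw [lintegral_mul_const _ (by fun_prop), mul_comm, sub_neg_eq_add, ← two_mul]

lemma lintegral_upper_half_plane {G : ℝ → ℝ → ℝ≥0∞} (hG : Measurable (Function.uncurry G)) :
    ∫⁻ z : ℝ, ∫⁻ r in Set.Ioi (0 : ℝ), G z r =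
      ∫⁻ ρ in Set.Ioi (0 : ℝ), ∫⁻ θ in Set.Ioo 0 π,
        ENNReal.ofReal ρ * G (ρ * Real.cos θ) (ρ * Real.sin θ) := by
  have htarget : MeasurableSet polarCoord.target := polarCoord.open_target.measurableSet
  have hS : MeasurableSet {p : ℝ × ℝ | 0 < p.2} := measurableSet_lt measurable_const measurable_snd
  have upper : ∀ p ∈ polarCoord.target, ENNReal.ofReal p.1 •
      {p : ℝ × ℝ | 0 < p.2}.indicator (Function.uncurry G) (polarCoord.symm p) =
      {p : ℝ × ℝ | 0 < p.2}.indicator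
        (fun p => ENNReal.ofReal p.1 * G (p.1 * Real.cos p.2) (p.1 * Real.sin p.2)) p := by
    rintro ⟨ρ, θ⟩ ⟨hρ, hθ⟩
    have hsin : 0 < ρ * Real.sin θ ↔ 0 < θ := by
      rw [mul_pos_iff_of_pos_left hρ]
      refine ⟨fun h => ?_, fun h => Real.sin_pos_of_pos_of_lt_pi h hθ.2⟩
      by_contra hneg
      exact (Real.sin_nonpos_of_nonpos_of_neg_pi_le (not_lt.1 hneg) hθ.1.le).not_gt h
    simp [polarCoord_symm_apply, Set.indicator, hsin]
  have inter : {p : ℝ × ℝ | 0 < p.2} ∩ polarCoord.target = Set.Ioi 0 ×ˢ Set.Ioo 0 π := by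
    ext ⟨ρ, θ⟩
    simp only [polarCoord_target, Set.mem_inter_iff, Set.mem_ofPred_eq, Set.mem_prod, Set.mem_Ioi,
      Set.mem_Ioo]
    exact ⟨fun h => ⟨h.2.1, h.1, h.2.2.2⟩,
      fun h => ⟨h.2.1, h.1, by linarith [Real.pi_pos], h.2.2⟩⟩
  calc ∫⁻ z : ℝ, ∫⁻ r in Set.Ioi (0 : ℝ), G z r
      = ∫⁻ p : ℝ × ℝ, {p : ℝ × ℝ | 0 < p.2}.indicator (Function.uncurry G) p := by
        rw [Measure.volume_eq_prod, lintegral_prod _ (hG.indicator hS).aemeasurable]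
        refine lintegral_congr fun z => ?_
        rw [← lintegral_indicator measurableSet_Ioi]
        rfl
    _ = ∫⁻ p in Set.Ioi (0 : ℝ) ×ˢ Set.Ioo 0 π,
          ENNReal.ofReal p.1 * G (p.1 * Real.cos p.2) (p.1 * Real.sin p.2) := by
        rw [← lintegral_comp_polarCoord_symm, setLIntegral_congr_fun htarget upper,
          setLIntegral_indicator hS, inter]
    _ = _ := by
        rw [Measure.volume_eq_prod, ← Measure.prod_restrict, lintegral_prod _ (by fun_prop)]

lemma lintegral_sin_mul_comp_cos (φ : ℝ → ℝ≥0∞) :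
    ∫⁻ θ in Set.Ioo 0 π, ENNReal.ofReal (Real.sin θ) * φ (Real.cos θ) =
      ∫⁻ s in Set.Icc (-1 : ℝ) 1, φ s := by
  rw [← Real.bijOn_cos.image_eq, lintegral_image_eq_lintegral_abs_deriv_mul measurableSet_Icc
    (fun x _ => (Real.hasDerivAt_cos x).hasDerivWithinAt) Real.injOn_cos,
    setLIntegral_congr Ioo_ae_eq_Icc]
  refine setLIntegral_congr_fun measurableSet_Icc fun θ hθ => ?_
  simp only [abs_neg, abs_of_nonneg (Real.sin_nonneg_of_nonneg_of_le_pi hθ.1 hθ.2)]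

lemma lintegral_comp_inner_norm_eq_lintegral_prod {e : Wave} (he : ‖e‖ = 1) {F : ℝ → ℝ → ℝ≥0∞}
    (hF : Measurable (Function.uncurry F)) :
    ∫⁻ x : Wave, F (inner ℝ e x) ‖x‖ =
      ∫⁻ z : ℝ, ∫⁻ y : ℝ × ℝ, F z √(z ^ 2 + (y.1 ^ 2 + y.2 ^ 2)) := by
  obtain ⟨b, hb⟩ := Orthonormal.exists_orthonormalBasis_extension_of_card_eq (𝕜 := ℝ) (E := Wave)
    (ι := Fin 3) (by simp) (v := fun _ => e) (s := {0})
    ⟨fun _ => he, fun i j hij => absurd (Subsingleton.elim i j) hij⟩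
  have hb0 : b 0 = e := hb 0 rfl
  have hF₁ : Measurable fun y : Wave => F (y 0) ‖y‖ :=
    hF.comp (Measurable.prodMk (by fun_prop) (by fun_prop))
  have hF₂ : Measurable fun p : ℝ × (Fin 2 → ℝ) => F p.1 √(p.1 ^ 2 + (p.2 0 ^ 2 + p.2 1 ^ 2)) :=
    hF.comp (Measurable.prodMk (by fun_prop) (by fun_prop))
  have hF₃ (z : ℝ) : Measurable fun y : ℝ × ℝ => F z √(z ^ 2 + (y.1 ^ 2 + y.2 ^ 2)) :=
    hF.comp (Measurable.prodMk (by fun_prop) (by fun_prop))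
  calc ∫⁻ x : Wave, F (inner ℝ e x) ‖x‖
      = ∫⁻ x : Wave, F (b.repr x 0) ‖b.repr x‖ := by
        simp only [LinearIsometryEquiv.norm_map, OrthonormalBasis.repr_apply_apply, hb0]
    _ = ∫⁻ y : Wave, F (y 0) ‖y‖ := b.measurePreserving_repr.lintegral_comp hF₁
    _ = ∫⁻ x : Fin 3 → ℝ, F (x 0) √(x 0 ^ 2 + (x 1 ^ 2 + x 2 ^ 2)) := by
        rw [← (PiLp.volume_preserving_toLp (Fin 3)).lintegral_comp hF₁]
        simp [EuclideanSpace.norm_eq, Fin.sum_univ_three, add_assoc]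
    _ = ∫⁻ p : ℝ × (Fin 2 → ℝ), F p.1 √(p.1 ^ 2 + (p.2 0 ^ 2 + p.2 1 ^ 2)) :=
        (volume_preserving_piFinSuccAbove (fun _ : Fin 3 => ℝ) 0).lintegral_comp hF₂
    _ = ∫⁻ z : ℝ, ∫⁻ y : ℝ × ℝ, F z √(z ^ 2 + (y.1 ^ 2 + y.2 ^ 2)) := by
        rw [Measure.volume_eq_prod, lintegral_prod _ hF₂.aemeasurable]
        exact lintegral_congr fun z => (volume_preserving_finTwoArrow ℝ).lintegral_comp (hF₃ z)

lemma lintegral_comp_inner_norm {e : Wave} (he : ‖e‖ = 1) {F : ℝ → ℝ → ℝ≥0∞}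
    (hF : Measurable (Function.uncurry F)) :
    ∫⁻ x : Wave, F (inner ℝ e x) ‖x‖ =
      ENNReal.ofReal (2 * π) * ∫⁻ ρ in Set.Ioi (0 : ℝ), ENNReal.ofReal (ρ ^ 2) *
        ∫⁻ s in Set.Icc (-1 : ℝ) 1, F (ρ * s) ρ := by
  have hF' : Measurable (Function.uncurry fun z r : ℝ => ENNReal.ofReal r * F z √(z ^ 2 + r ^ 2)) :=
    Measurable.mul (by fun_prop) (hF.comp (g := Function.uncurry F)
      (f := fun p : ℝ × ℝ => (p.1, √(p.1 ^ 2 + p.2 ^ 2))) (by fun_prop))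
  have azimuth (z : ℝ) : ∫⁻ y : ℝ × ℝ, F z √(z ^ 2 + (y.1 ^ 2 + y.2 ^ 2)) =
      ENNReal.ofReal (2 * π) *
        ∫⁻ r in Set.Ioi (0 : ℝ), ENNReal.ofReal r * F z √(z ^ 2 + r ^ 2) := by
    rw [← lintegral_comp_sqrt_sq_add_sq (g := fun r => F z √(z ^ 2 + r ^ 2))
      (hF.comp (Measurable.prodMk (by fun_prop) (by fun_prop)))]
    refine lintegral_congr fun y => ?_
    rw [Real.sq_sqrt (by positivity)]
  rw [lintegral_comp_inner_norm_eq_lintegral_prod he hF, lintegral_congr azimuth,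
    lintegral_const_mul _ (Measurable.lintegral_prod_right hF'), lintegral_upper_half_plane hF']
  congr 1
  refine setLIntegral_congr_fun measurableSet_Ioi fun ρ hρ => ?_
  have hρ₀ : 0 ≤ ρ := (Set.mem_Ioi.1 hρ).le
  rw [← lintegral_sin_mul_comp_cos fun s => F (ρ * s) ρ,
    ← lintegral_const_mul' _ _ ENNReal.ofReal_ne_top]
  refine lintegral_congr fun θ => ?_
  have hsq : (ρ * Real.cos θ) ^ 2 + (ρ * Real.sin θ) ^ 2 = ρ ^ 2 := by
    linear_combination ρ ^ 2 * Real.cos_sq_add_sin_sq θ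
  rw [hsq, Real.sqrt_sq hρ₀, ENNReal.ofReal_mul hρ₀, sq, ENNReal.ofReal_mul hρ₀]
  ring

theorem lintegral_surface_inner {e : Wave} (he : ‖e‖ = 1) {φ : ℝ → ℝ≥0∞} (hφ : Measurable φ) :
    ∫⁻ σ : Sph, φ (inner ℝ e (σ : Wave)) ∂surface =
      ENNReal.ofReal (2 * π) * ∫⁻ s in Set.Icc (-1 : ℝ) 1, φ s := by
  set g : ℝ → ℝ≥0∞ := (Set.Iio (1 : ℝ)).indicator 1
  have hg : Measurable g := measurable_one.indicator measurableSet_Iio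
  set m : ℝ≥0∞ := ∫⁻ ρ in Set.Ioi (0 : ℝ), ENNReal.ofReal (ρ ^ 2) * g ρ
  have hm : m = ENNReal.ofReal (1 / 3) := by
    simp only [m, g]
    have hsq : ContinuousOn (fun ρ : ℝ => ρ ^ 2) (Set.Icc 0 1) := by fun_prop
    calc ∫⁻ ρ in Set.Ioi (0 : ℝ), ENNReal.ofReal (ρ ^ 2) * (Set.Iio (1 : ℝ)).indicator 1 ρ
        = ∫⁻ ρ in Set.Icc (0 : ℝ) 1, ENNReal.ofReal (ρ ^ 2) := by
          rw [← setLIntegral_congr Ioo_ae_eq_Icc, ← Set.Iio_inter_Ioi,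
            ← setLIntegral_indicator measurableSet_Iio]
          simp only [Set.indicator_apply, mul_ite, mul_zero, Pi.one_apply, mul_one]
      _ = ENNReal.ofReal (∫ ρ in (0 : ℝ)..1, ρ ^ 2) := by
          rw [← ofReal_integral_eq_lintegral_ofReal hsq.integrableOn_Icc
            (Eventually.of_forall fun ρ => sq_nonneg ρ), integral_Icc_eq_integral_Ioc,
            ← intervalIntegral.integral_of_le zero_le_one]
      _ = ENNReal.ofReal (1 / 3) := by norm_num [integral_pow]
  have spherical : ∫⁻ x : Wave, φ (inner ℝ e x / ‖x‖) * g ‖x‖ =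
      (∫⁻ σ : Sph, φ (inner ℝ e (σ : Wave)) ∂surface) * m := by
    have h := lintegral_comp_normalize_mul_comp_norm (volume : Measure Wave)
      (φ := fun x => φ (inner ℝ e x)) (by fun_prop) hg
    simp only [inner_smul_right, inv_mul_eq_div, finrank_euclideanSpace, Fintype.card_fin] at h
    exact h
  have cylindrical : ∫⁻ x : Wave, φ (inner ℝ e x / ‖x‖) * g ‖x‖ =
      (ENNReal.ofReal (2 * π) * ∫⁻ s in Set.Icc (-1 : ℝ) 1, φ s) * m := by
    rw [lintegral_comp_inner_norm he (F := fun z ρ => φ (z / ρ) * g ρ)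
      ((hφ.comp (by fun_prop)).mul (hg.comp measurable_snd)), mul_assoc]
    congr 1
    rw [← lintegral_const_mul _ (by fun_prop)]
    refine setLIntegral_congr_fun measurableSet_Ioi fun ρ hρ => ?_
    simp only [mul_div_cancel_left₀ _ (Set.mem_Ioi.1 hρ).ne']
    rw [lintegral_mul_const _ hφ]
    ring
  have hm₀ : m ≠ 0 := by simp [hm]
  exact (ENNReal.mul_left_inj hm₀ (hm ▸ ENNReal.ofReal_ne_top)).1 (spherical.symm.trans cylindrical)

lemma lintegral_inv_sq_sub_mul {a b : ℝ} (hab : |b| < a) :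
    ∫⁻ s in Set.Icc (-1 : ℝ) 1, ENNReal.ofReal (((a - b * s) ^ 2)⁻¹) =
      ENNReal.ofReal (2 / (a ^ 2 - b ^ 2)) := by
  obtain ⟨hb₁, hb₂⟩ := abs_lt.1 hab
  have ha : 0 < a := (abs_nonneg b).trans_lt hab
  have hpos (s : ℝ) (hs : s ∈ Set.Icc (-1 : ℝ) 1) : 0 < a - b * s := by
    have : |b * s| ≤ |b| := by
      rw [abs_mul]
      exact mul_le_of_le_one_right (abs_nonneg _) (abs_le.2 hs)
    linarith [le_abs_self (b * s)]
  have hcont : ContinuousOn (fun s => ((a - b * s) ^ 2)⁻¹) (Set.Icc (-1 : ℝ) 1) :=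
    ContinuousOn.inv₀ (by fun_prop) fun s hs => (pow_pos (hpos s hs) 2).ne'
  have hderiv : ∀ s ∈ Set.uIcc (-1 : ℝ) 1,
      HasDerivAt (fun s => s / (a * (a - b * s))) ((a - b * s) ^ 2)⁻¹ s := by
    intro s hs
    rw [Set.uIcc_of_le (by norm_num)] at hs
    have := hpos s hs
    have hd : HasDerivAt (fun s => a * (a - b * s)) (a * (-b)) s := by
      simpa using (((hasDerivAt_id s).const_mul b).const_sub a).const_mul a
    refine ((hasDerivAt_id' s).fun_div hd (by positivity)).congr_deriv ?_
    field_simp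
    ring
  rw [← ofReal_integral_eq_lintegral_ofReal hcont.integrableOn_Icc
    (Eventually.of_forall fun s => by positivity), integral_Icc_eq_integral_Ioc,
    ← intervalIntegral.integral_of_le (by norm_num),
    intervalIntegral.integral_eq_sub_of_hasDerivAt hderiv
      (hcont.mono (Set.uIcc_of_le (by norm_num)).le).intervalIntegrable]
  have h₁ : a - b ≠ 0 := by linarith
  have h₂ : a + b ≠ 0 := by linarith
  rw [sq_sub_sq, mul_one, mul_neg_one, sub_neg_eq_add]
  congr 1
  field_simp
  ring

lemma exists_norm_eq_one_and_eq_norm_smul {E : Type*} [NormedAddCommGroup E] [NormedSpace ℝ E]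
    [Nontrivial E] (c : E) : ∃ e : E, ‖e‖ = 1 ∧ c = ‖c‖ • e := by
  by_cases hc : c = 0
  · obtain ⟨e, he⟩ := exists_norm_eq E (zero_le_one (α := ℝ))
    exact ⟨e, he, by simp [hc]⟩
  · have : ‖c‖ ≠ 0 := norm_ne_zero_iff.2 hc
    exact ⟨‖c‖⁻¹ • c, by simp [norm_smul, this], by simp [smul_smul, this]⟩

lemma norm_sub_smul_sq {E : Type*} [NormedAddCommGroup E] [InnerProductSpace ℝ E] {c e σ : E}
    (hc : c = ‖c‖ • e) (hσ : ‖σ‖ = 1) (r : ℝ) :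
    ‖c - r • σ‖ ^ 2 = ‖c‖ ^ 2 + r ^ 2 - 2 * r * ‖c‖ * inner ℝ e σ := by
  have hinner : inner ℝ c σ = ‖c‖ * inner ℝ e σ := by
    conv_lhs => rw [hc]
    rw [real_inner_smul_left]
  rw [norm_sub_sq_real, real_inner_smul_right, hinner, norm_smul, hσ, mul_one, Real.norm_eq_abs,
    sq_abs]
  ring

lemma norm_coe_sph (σ : Sph) : ‖(σ : Wave)‖ = 1 := norm_eq_of_mem_sphere σ

lemma bracket_sq (k : Wave) : bracket k ^ 2 = 1 + ‖k‖ ^ 2 := Real.sq_sqrt (by positivity)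

lemma one_le_bracket (k : Wave) : 1 ≤ bracket k :=
  Real.one_le_sqrt.2 (le_add_of_nonneg_right (sq_nonneg _))

lemma bracket_pos (k : Wave) : 0 < bracket k := one_pos.trans_le (one_le_bracket k)

lemma norm_le_bracket (k : Wave) : ‖k‖ ≤ bracket k := Real.le_sqrt_of_sq_le (by linarith)

@[fun_prop]
lemma measurable_bracket : Measurable bracket := by
  unfold bracket
  fun_prop

lemma bracket_le_mul (k₁ k₂ : Wave) : bracket k₁ ≤ 2 * (bracket k₂ * bracket (k₁ - k₂)) := by
  have hadd : ‖k₁‖ ^ 2 ≤ (‖k₂‖ + ‖k₁ - k₂‖) ^ 2 := by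
    gcongr
    exact norm_le_norm_add_norm_sub' k₁ k₂
  have h₂ := bracket_pos k₂
  have h₁₂ := bracket_pos (k₁ - k₂)
  refine le_of_sq_le_sq ?_ (by positivity)
  rw [mul_pow, mul_pow, bracket_sq, bracket_sq, bracket_sq]
  nlinarith [sq_nonneg (‖k₂‖ - ‖k₁ - k₂‖), mul_nonneg (sq_nonneg ‖k₂‖) (sq_nonneg ‖k₁ - k₂‖)]

lemma integrable_bracket_rpow {p : ℝ} (hp : 3 < p) :
    Integrable fun k : Wave => bracket k ^ (-p) := by
  have h := integrable_rpow_neg_one_add_norm_sq (E := Wave) (μ := volume) (r := p)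
    (by simpa using hp)
  refine h.congr (Eventually.of_forall fun k => ?_)
  simp only [bracket, Real.sqrt_eq_rpow]
  rw [← Real.rpow_mul (by positivity)]
  congr 1
  ring

lemma lintegral_surface_inv_bracket_pow_four_le (c : Wave) (r : ℝ) :
    ∫⁻ σ : Sph, ENNReal.ofReal ((bracket (c - r • (σ : Wave)) ^ 4)⁻¹) ∂surface ≤
      ENNReal.ofReal (4 * π / (1 + r ^ 2)) := by
  obtain ⟨e, he, hc⟩ := exists_norm_eq_one_and_eq_norm_smul c
  set a := 1 + ‖c‖ ^ 2 + r ^ 2 with ha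
  set b := 2 * r * ‖c‖ with hb
  have hab : |b| < a := abs_lt.2
    ⟨by nlinarith [sq_nonneg (r + ‖c‖)], by nlinarith [sq_nonneg (r - ‖c‖)]⟩
  have hbracket (σ : Sph) :
      bracket (c - r • (σ : Wave)) ^ 4 = (a - b * inner ℝ e (σ : Wave)) ^ 2 := by
    rw [show 4 = 2 * 2 from rfl, pow_mul, bracket_sq, norm_sub_smul_sq hc (norm_coe_sph σ)]
    ring
  have hlower : 1 + r ^ 2 ≤ a ^ 2 - b ^ 2 := by
    have : a ^ 2 - b ^ 2 = (1 + (‖c‖ - r) ^ 2) * (1 + (‖c‖ + r) ^ 2) := by rw [ha, hb]; ring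
    rw [this]
    nlinarith [mul_nonneg (sq_nonneg (‖c‖ - r)) (sq_nonneg (‖c‖ + r)), sq_nonneg ‖c‖]
  simp only [hbracket]
  rw [lintegral_surface_inner he (φ := fun s => ENNReal.ofReal (((a - b * s) ^ 2)⁻¹)) (by fun_prop),
    lintegral_inv_sq_sub_mul hab, ← ENNReal.ofReal_mul (by positivity)]
  calc ENNReal.ofReal (2 * π * (2 / (a ^ 2 - b ^ 2)))
      = ENNReal.ofReal (4 * π / (a ^ 2 - b ^ 2)) := by ring_nf
    _ ≤ ENNReal.ofReal (4 * π / (1 + r ^ 2)) := by gcongr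

instance : SFinite surface := by unfold surface; infer_instance

/-- The measure `dk₂ dσ` over which the collision operator integrates. -/
abbrev collisionMeasure : Measure (Wave × Sph) := (volume : Measure Wave).prod surface

@[fun_prop]
lemma measurable_out₁ : Measurable fun p : Wave × Wave × Sph => out₁ p.1 p.2.1 p.2.2 := by
  unfold out₁
  fun_prop

@[fun_prop]
lemma measurable_out₂ : Measurable fun p : Wave × Wave × Sph => out₂ p.1 p.2.1 p.2.2 := by
  unfold out₂
  fun_prop

lemma norm_out_sq_add_norm_out_sq (k₁ k₂ : Wave) (σ : Sph) :
    ‖out₁ k₁ k₂ σ‖ ^ 2 + ‖out₂ k₁ k₂ σ‖ ^ 2 = ‖k₁‖ ^ 2 + ‖k₂‖ ^ 2 := by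
  have hout := parallelogram_law_with_norm ℝ ((1 / 2 : ℝ) • (k₁ + k₂))
    ((‖k₁ - k₂‖ / 2) • (σ : Wave))
  have hin := parallelogram_law_with_norm ℝ k₁ k₂
  have hmid : ‖(1 / 2 : ℝ) • (k₁ + k₂)‖ = ‖k₁ + k₂‖ / 2 := by
    rw [norm_smul, Real.norm_of_nonneg (by norm_num)]
    ring
  have hrad : ‖(‖k₁ - k₂‖ / 2) • (σ : Wave)‖ = ‖k₁ - k₂‖ / 2 := by
    rw [norm_smul, norm_coe_sph, Real.norm_of_nonneg (by positivity), mul_one]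
  rw [hmid, hrad] at hout
  simp only [out₁, out₂]
  nlinarith

lemma lintegral_surface_inv_bracket_out_le (k₁ k₂ : Wave) :
    ∫⁻ σ : Sph, ENNReal.ofReal ((bracket (out₁ k₁ k₂ σ) ^ 4)⁻¹ + (bracket (out₂ k₁ k₂ σ) ^ 4)⁻¹)
      ∂surface ≤ ENNReal.ofReal (32 * π / bracket (k₁ - k₂) ^ 2) := by
  have hb := bracket_pos (k₁ - k₂)
  have hle (r : ℝ) (hr : r ^ 2 = (‖k₁ - k₂‖ / 2) ^ 2) :
      ∫⁻ σ : Sph, ENNReal.ofReal ((bracket ((1 / 2 : ℝ) • (k₁ + k₂) - r • (σ : Wave)) ^ 4)⁻¹)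
        ∂surface ≤ ENNReal.ofReal (16 * π / bracket (k₁ - k₂) ^ 2) := by
    refine (lintegral_surface_inv_bracket_pow_four_le _ r).trans (ENNReal.ofReal_le_ofReal ?_)
    have hr' : bracket (k₁ - k₂) ^ 2 / 4 ≤ 1 + r ^ 2 := by rw [hr, bracket_sq]; linarith
    calc 4 * π / (1 + r ^ 2) ≤ 4 * π / (bracket (k₁ - k₂) ^ 2 / 4) := by gcongr
      _ = 16 * π / bracket (k₁ - k₂) ^ 2 := by field_simp; norm_num
  have h₁ := hle (-(‖k₁ - k₂‖ / 2)) (neg_sq _)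
  have h₂ := hle (‖k₁ - k₂‖ / 2) rfl
  simp only [neg_smul, sub_neg_eq_add] at h₁
  simp only [out₁, out₂]
  calc _ = (∫⁻ σ : Sph, ENNReal.ofReal ((bracket ((1 / 2 : ℝ) • (k₁ + k₂) +
            (‖k₁ - k₂‖ / 2) • (σ : Wave)) ^ 4)⁻¹) ∂surface) +
          ∫⁻ σ : Sph, ENNReal.ofReal ((bracket ((1 / 2 : ℝ) • (k₁ + k₂) -
            (‖k₁ - k₂‖ / 2) • (σ : Wave)) ^ 4)⁻¹) ∂surface := by
        rw [← lintegral_add_left (by fun_prop)]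
        refine lintegral_congr fun σ => ENNReal.ofReal_add ?_ ?_ <;> positivity
    _ ≤ _ := add_le_add h₁ h₂
    _ = _ := by
        rw [← ENNReal.ofReal_add (by positivity) (by positivity)]
        ring_nf

lemma exists_lintegral_inv_bracket_out_le {p : ℝ} (hp : 4 < p) : ∃ K : ℝ, 0 < K ∧ ∀ k₁ : Wave,
    ∫⁻ q, ENNReal.ofReal (‖k₁ - q.1‖ * bracket q.1 ^ (-p) *
      ((bracket (out₁ k₁ q.1 q.2) ^ 4)⁻¹ + (bracket (out₂ k₁ q.1 q.2) ^ 4)⁻¹)) ∂collisionMeasure ≤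
    ENNReal.ofReal (K * (bracket k₁)⁻¹) := by
  have hint := integrable_bracket_rpow (p := p - 1) (by linarith)
  have hnonneg (k : Wave) : 0 ≤ bracket k ^ (-(p - 1)) := Real.rpow_nonneg (bracket_pos k).le _
  set I := ∫ k : Wave, bracket k ^ (-(p - 1)) with hI
  have hI₀ : 0 ≤ I := integral_nonneg hnonneg
  refine ⟨64 * π * (I + 1), by positivity, fun k₁ => ?_⟩
  have hb₁ := bracket_pos k₁
  have inner_le (k₂ : Wave) : ∫⁻ σ : Sph, ENNReal.ofReal (‖k₁ - k₂‖ * bracket k₂ ^ (-p) *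
        ((bracket (out₁ k₁ k₂ σ) ^ 4)⁻¹ + (bracket (out₂ k₁ k₂ σ) ^ 4)⁻¹)) ∂surface ≤
      ENNReal.ofReal (64 * π * (bracket k₁)⁻¹ * bracket k₂ ^ (-(p - 1))) := by
    have hb₂ := bracket_pos k₂
    have hb := bracket_pos (k₁ - k₂)
    have hfactor : 0 ≤ ‖k₁ - k₂‖ * bracket k₂ ^ (-p) := by positivity
    simp_rw [ENNReal.ofReal_mul hfactor]
    rw [lintegral_const_mul' _ _ ENNReal.ofReal_ne_top]
    refine (mul_le_mul_right (lintegral_surface_inv_bracket_out_le k₁ k₂) _).trans ?_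
    rw [← ENNReal.ofReal_mul hfactor]
    refine ENNReal.ofReal_le_ofReal ?_
    have hinv : 1 / bracket (k₁ - k₂) ≤ 2 * bracket k₂ / bracket k₁ := by
      rw [div_le_div_iff₀ hb hb₁]
      linarith [bracket_le_mul k₁ k₂]
    calc ‖k₁ - k₂‖ * bracket k₂ ^ (-p) * (32 * π / bracket (k₁ - k₂) ^ 2)
        ≤ bracket (k₁ - k₂) * bracket k₂ ^ (-p) * (32 * π / bracket (k₁ - k₂) ^ 2) := by
          gcongr
          exact norm_le_bracket _
      _ = 32 * π * bracket k₂ ^ (-p) * (1 / bracket (k₁ - k₂)) := by field_simp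
      _ ≤ 32 * π * bracket k₂ ^ (-p) * (2 * bracket k₂ / bracket k₁) := by gcongr
      _ = 64 * π * (bracket k₁)⁻¹ * bracket k₂ ^ (-(p - 1)) := by
          rw [neg_sub, sub_eq_neg_add, Real.rpow_add_one hb₂.ne']
          ring
  rw [lintegral_prod _ (by fun_prop)]
  refine (lintegral_mono inner_le).trans ?_
  rw [← ofReal_integral_eq_lintegral_ofReal (hint.const_mul _)
    (Eventually.of_forall fun k => mul_nonneg (by positivity) (hnonneg k)),
    integral_const_mul, ← hI]
  refine ENNReal.ofReal_le_ofReal ?_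
  nlinarith [mul_pos Real.pi_pos (inv_pos.2 hb₁)]

/-- The kernel of the collision operator with respect to `collisionMeasure`. -/
def collisionKernel (β : ℝ) (k₁ : Wave) (q : Wave × Sph) : ℝ :=
  (‖k₁‖ * ‖q.1‖ * ‖out₁ k₁ q.1 q.2‖ * ‖out₂ k₁ q.1 q.2‖) ^ (2 * β) * ‖k₁ - q.1‖

/-- The decay in `k₂` and in one of the outgoing wave vectors that is left of a product of three
densities of size `⟨k⟩^(-M)` once `⟨k₁⟩^(-M)` has been taken out. The exponent `2 - M` in place of
`-M` leaves room for the remainders that gain a factor `⟨k₁⟩^(-2)`. -/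
def decayWeight (M : ℝ) (k₁ : Wave) (q : Wave × Sph) : ℝ :=
  bracket q.1 ^ (2 - M) *
    (bracket (out₁ k₁ q.1 q.2) ^ (2 - M) + bracket (out₂ k₁ q.1 q.2) ^ (2 - M))

lemma collisionKernel_nonneg (β : ℝ) (k₁ : Wave) (q : Wave × Sph) : 0 ≤ collisionKernel β k₁ q := by
  unfold collisionKernel
  positivity

lemma decayWeight_nonneg (M : ℝ) (k₁ : Wave) (q : Wave × Sph) : 0 ≤ decayWeight M k₁ q := by
  have h₂ := bracket_pos q.1
  have h₃ := bracket_pos (out₁ k₁ q.1 q.2)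
  have h₄ := bracket_pos (out₂ k₁ q.1 q.2)
  unfold decayWeight
  positivity

@[fun_prop]
lemma measurable_collisionKernel (β : ℝ) (k₁ : Wave) : Measurable (collisionKernel β k₁) := by
  unfold collisionKernel
  fun_prop

@[fun_prop]
lemma measurable_decayWeight (M : ℝ) (k₁ : Wave) : Measurable (decayWeight M k₁) := by
  unfold decayWeight
  fun_prop

lemma norm_le_bracket_mul_bracket {k₁ k₂ x y : Wave}
    (h : ‖x‖ ^ 2 + ‖y‖ ^ 2 = ‖k₁‖ ^ 2 + ‖k₂‖ ^ 2) : ‖x‖ ≤ bracket k₁ * bracket k₂ := by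
  refine le_of_sq_le_sq ?_ (mul_pos (bracket_pos _) (bracket_pos _)).le
  rw [mul_pow, bracket_sq, bracket_sq]
  nlinarith [sq_nonneg ‖y‖, mul_nonneg (sq_nonneg ‖k₁‖) (sq_nonneg ‖k₂‖)]

lemma mul_norm_rpow_le {β : ℝ} (hβ : 0 ≤ β) {k₁ k₂ x y : Wave}
    (h : ‖x‖ ^ 2 + ‖y‖ ^ 2 = ‖k₁‖ ^ 2 + ‖k₂‖ ^ 2) :
    (‖k₁‖ * ‖k₂‖ * ‖x‖ * ‖y‖) ^ (2 * β) ≤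
      bracket k₁ ^ (4 * β) * bracket k₂ ^ (4 * β) * bracket y ^ (2 * β) := by
  have hb₁ := bracket_pos k₁
  have hb₂ := bracket_pos k₂
  have hb := bracket_pos y
  calc (‖k₁‖ * ‖k₂‖ * ‖x‖ * ‖y‖) ^ (2 * β)
      ≤ (bracket k₁ * bracket k₂ * (bracket k₁ * bracket k₂) * bracket y) ^ (2 * β) := by
        gcongr <;> first | exact norm_le_bracket _ | exact norm_le_bracket_mul_bracket h
    _ = (bracket k₁ ^ (2 : ℝ) * bracket k₂ ^ (2 : ℝ) * bracket y) ^ (2 * β) := by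
        rw [Real.rpow_two, Real.rpow_two]
        ring_nf
    _ = bracket k₁ ^ (4 * β) * bracket k₂ ^ (4 * β) * bracket y ^ (2 * β) := by
        rw [Real.mul_rpow (by positivity) hb.le, Real.mul_rpow (by positivity) (by positivity),
          ← Real.rpow_mul hb₁.le, ← Real.rpow_mul hb₂.le]
        ring_nf

lemma mul_norm_rpow_mul_bracket_rpow_le {β M : ℝ} (hβ : 0 ≤ β) (hM : 6 + 2 * β ≤ M)
    {k₁ k₂ x y : Wave} (h : ‖x‖ ^ 2 + ‖y‖ ^ 2 = ‖k₁‖ ^ 2 + ‖k₂‖ ^ 2) :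
    (‖k₁‖ * ‖k₂‖ * ‖x‖ * ‖y‖) ^ (2 * β) * (bracket k₂ ^ (2 - M) * bracket y ^ (2 - M)) ≤
      bracket k₁ ^ (4 * β) * (bracket k₂ ^ (-(M - 2 - 4 * β)) * (bracket y ^ 4)⁻¹) := by
  have hb₁ := bracket_pos k₁
  have hb₂ := bracket_pos k₂
  have hb := bracket_pos y
  have hy : bracket y ^ (2 * β) * bracket y ^ (2 - M) ≤ (bracket y ^ 4)⁻¹ := by
    rw [← Real.rpow_add hb, ← Real.rpow_natCast, ← Real.rpow_neg hb.le]
    refine Real.rpow_le_rpow_of_exponent_le (one_le_bracket y) ?_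
    push_cast
    linarith
  calc (‖k₁‖ * ‖k₂‖ * ‖x‖ * ‖y‖) ^ (2 * β) * (bracket k₂ ^ (2 - M) * bracket y ^ (2 - M))
      ≤ bracket k₁ ^ (4 * β) * bracket k₂ ^ (4 * β) * bracket y ^ (2 * β) *
          (bracket k₂ ^ (2 - M) * bracket y ^ (2 - M)) := by
        gcongr
        exact mul_norm_rpow_le hβ h
    _ = bracket k₁ ^ (4 * β) * (bracket k₂ ^ (-(M - 2 - 4 * β)) *
          (bracket y ^ (2 * β) * bracket y ^ (2 - M))) := by
        rw [show -(M - 2 - 4 * β) = 4 * β + (2 - M) by ring, Real.rpow_add hb₂]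
        ring
    _ ≤ _ := by gcongr

lemma collisionKernel_mul_decayWeight_le {β M : ℝ} (hβ : 0 ≤ β) (hM : 6 + 2 * β ≤ M) (k₁ : Wave)
    (q : Wave × Sph) :
    collisionKernel β k₁ q * decayWeight M k₁ q ≤
      bracket k₁ ^ (4 * β) * (‖k₁ - q.1‖ * bracket q.1 ^ (-(M - 2 - 4 * β)) *
        ((bracket (out₁ k₁ q.1 q.2) ^ 4)⁻¹ + (bracket (out₂ k₁ q.1 q.2) ^ 4)⁻¹)) := by
  have henergy := norm_out_sq_add_norm_out_sq k₁ q.1 q.2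
  have h₁ := mul_le_mul_of_nonneg_left
    (mul_norm_rpow_mul_bracket_rpow_le hβ hM ((add_comm _ _).trans henergy))
    (norm_nonneg (k₁ - q.1))
  have h₂ := mul_le_mul_of_nonneg_left
    (mul_norm_rpow_mul_bracket_rpow_le hβ hM henergy) (norm_nonneg (k₁ - q.1))
  rw [mul_right_comm _ ‖out₂ k₁ q.1 q.2‖] at h₁
  simp only [collisionKernel, decayWeight]
  linarith

theorem exists_lintegral_collisionKernel_mul_decayWeight_le {β M : ℝ} (hβ : 0 ≤ β)
    (hM : 6 + 4 * β < M) :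
    ∃ K : ℝ, 0 < K ∧ ∀ k₁ : Wave,
      ∫⁻ q, ENNReal.ofReal (collisionKernel β k₁ q * decayWeight M k₁ q) ∂collisionMeasure ≤
        ENNReal.ofReal (K * bracket k₁ ^ (4 * β - 1)) := by
  obtain ⟨K, hK, hle⟩ := exists_lintegral_inv_bracket_out_le (p := M - 2 - 4 * β) (by linarith)
  refine ⟨K, hK, fun k₁ => ?_⟩
  have hb₁ := bracket_pos k₁
  refine (lintegral_mono fun q => ENNReal.ofReal_le_ofReal
    (collisionKernel_mul_decayWeight_le hβ (by linarith) k₁ q)).trans ?_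
  simp_rw [ENNReal.ofReal_mul (Real.rpow_nonneg hb₁.le (4 * β))]
  rw [lintegral_const_mul' _ _ ENNReal.ofReal_ne_top]
  refine (mul_le_mul_right (hle k₁) _).trans (le_of_eq ?_)
  rw [← ENNReal.ofReal_mul (by positivity), Real.rpow_sub_one hb₁.ne']
  ring_nf

lemma exists_integral_collisionKernel_mul_decayWeight_le {β M : ℝ} (hβ : 0 ≤ β)
    (hM : 6 + 4 * β < M) :
    ∃ K : ℝ, 0 < K ∧ ∀ k₁ : Wave,
      Integrable (fun q => collisionKernel β k₁ q * decayWeight M k₁ q) collisionMeasure ∧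
      ∫ q, collisionKernel β k₁ q * decayWeight M k₁ q ∂collisionMeasure ≤
        K * bracket k₁ ^ (4 * β - 1) := by
  obtain ⟨K, hK, hle⟩ := exists_lintegral_collisionKernel_mul_decayWeight_le hβ hM
  refine ⟨K, hK, fun k₁ => ?_⟩
  have hb₁ := bracket_pos k₁
  have hnonneg (q : Wave × Sph) : 0 ≤ collisionKernel β k₁ q * decayWeight M k₁ q :=
    mul_nonneg (collisionKernel_nonneg β k₁ q) (decayWeight_nonneg M k₁ q)
  have hmeas : Measurable fun q => collisionKernel β k₁ q * decayWeight M k₁ q := by fun_prop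
  refine ⟨⟨hmeas.aestronglyMeasurable, ?_⟩, ?_⟩
  · rw [hasFiniteIntegral_iff_ofReal (Eventually.of_forall hnonneg)]
    exact (hle k₁).trans_lt ENNReal.ofReal_lt_top
  · rw [integral_eq_lintegral_of_nonneg_ae (Eventually.of_forall hnonneg)
      hmeas.aestronglyMeasurable]
    exact ENNReal.toReal_le_of_le_ofReal (by positivity) (hle k₁)

lemma abs_mul_mul_sub_mul_mul_le {a b c a' b' c' u v w G ε : ℝ}
    (hb : |b| ≤ G * v) (hc : |c| ≤ G * w) (ha' : |a'| ≤ G * u) (hb' : |b'| ≤ G * v)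
    (hda : |a - a'| ≤ ε * u) (hdb : |b - b'| ≤ ε * v) (hdc : |c - c'| ≤ ε * w) :
    |a * b * c - a' * b' * c'| ≤ 3 * ε * G ^ 2 * (u * v * w) := by
  have telescope : a * b * c - a' * b' * c' =
      (a - a') * b * c + a' * (b - b') * c + a' * b' * (c - c') := by ring
  have mul_le {x y z X Y Z : ℝ} (hx : |x| ≤ X) (hy : |y| ≤ Y) (hz : |z| ≤ Z) :
      |x * y * z| ≤ X * Y * Z := by
    rw [abs_mul, abs_mul]
    have := (abs_nonneg _).trans hx
    have := (abs_nonneg _).trans hy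
    gcongr
  rw [telescope]
  refine (abs_add_three _ _ _).trans ?_
  linarith [mul_le hda hb hc, mul_le ha' hdb hc, mul_le ha' hb' hdc]

lemma abs_gainLoss_sub_gainLoss_le {f₁ f₂ f₃ f₄ g₁ g₂ g₃ g₄ w₁ w₂ w₃ w₄ G ε : ℝ}
    (h₁ : |f₁| ≤ G * w₁ ∧ |g₁| ≤ G * w₁ ∧ |f₁ - g₁| ≤ ε * w₁)
    (h₂ : |f₂| ≤ G * w₂ ∧ |g₂| ≤ G * w₂ ∧ |f₂ - g₂| ≤ ε * w₂)
    (h₃ : |f₃| ≤ G * w₃ ∧ |g₃| ≤ G * w₃ ∧ |f₃ - g₃| ≤ ε * w₃)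
    (h₄ : |f₄| ≤ G * w₄ ∧ |g₄| ≤ G * w₄ ∧ |f₄ - g₄| ≤ ε * w₄) :
    |gainLoss f₁ f₂ f₃ f₄ - gainLoss g₁ g₂ g₃ g₄| ≤ 3 * ε * G ^ 2 *
      (w₂ * w₃ * w₄ + w₁ * w₃ * w₄ + w₁ * w₂ * w₄ + w₁ * w₂ * w₃) := by
  obtain ⟨_, b₁, c₁⟩ := h₁
  obtain ⟨a₂, b₂, c₂⟩ := h₂
  obtain ⟨a₃, b₃, c₃⟩ := h₃
  obtain ⟨a₄, _, c₄⟩ := h₄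
  have e₁ := abs_le.1 (abs_mul_mul_sub_mul_mul_le a₃ a₄ b₂ b₃ c₂ c₃ c₄)
  have e₂ := abs_le.1 (abs_mul_mul_sub_mul_mul_le a₃ a₄ b₁ b₃ c₁ c₃ c₄)
  have e₃ := abs_le.1 (abs_mul_mul_sub_mul_mul_le a₂ a₄ b₁ b₂ c₁ c₂ c₄)
  have e₄ := abs_le.1 (abs_mul_mul_sub_mul_mul_le a₂ a₃ b₁ b₂ c₁ c₂ c₃)
  unfold gainLoss
  exact abs_le.2 ⟨by linarith, by linarith⟩

lemma sum_triple_products_le {w₁ w₂ w₃ w₄ D : ℝ} (h₁ : 0 ≤ w₁) (h₂ : 0 ≤ w₂) (h₃ : 0 ≤ w₃)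
    (h₄ : 0 ≤ w₄) (hD : 0 ≤ D) (h₃₁ : w₃ ≤ D * w₁) (h₃₂ : w₃ ≤ D * w₂) :
    w₂ * w₃ * w₄ + w₁ * w₃ * w₄ + w₁ * w₂ * w₄ + w₁ * w₂ * w₃ ≤
      (2 * D + 1) * (w₁ * (w₂ * (w₃ + w₄))) := by
  have e₁ := mul_le_mul_of_nonneg_left h₃₁ (mul_nonneg h₂ h₄)
  have e₂ := mul_le_mul_of_nonneg_left h₃₂ (mul_nonneg h₁ h₄)
  have e₃ : 0 ≤ D * (w₁ * (w₂ * w₃)) := by positivity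
  nlinarith

lemma bracket_le_two_mul_bracket {k₁ k₂ x y : Wave} (h : ‖x‖ ^ 2 + ‖y‖ ^ 2 = ‖k₁‖ ^ 2 + ‖k₂‖ ^ 2)
    (hyx : ‖y‖ ≤ ‖x‖) : bracket k₁ ≤ 2 * bracket x ∧ bracket k₂ ≤ 2 * bracket x := by
  have hx := bracket_pos x
  have hyx₂ : ‖y‖ ^ 2 ≤ ‖x‖ ^ 2 := by gcongr
  constructor <;>
  · refine le_of_sq_le_sq ?_ (by positivity)
    rw [mul_pow, bracket_sq, bracket_sq]
    nlinarith [sq_nonneg ‖k₁‖, sq_nonneg ‖k₂‖]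

lemma bracket_rpow_neg_le_of_le_two_mul {M : ℝ} (hM : 0 ≤ M) {k x : Wave}
    (h : bracket k ≤ 2 * bracket x) : bracket x ^ (-M) ≤ 2 ^ M * bracket k ^ (-M) := by
  have hx := bracket_pos x
  calc bracket x ^ (-M) = 2 ^ M * (2 * bracket x) ^ (-M) := by
        rw [Real.mul_rpow (by norm_num) hx.le, ← mul_assoc, ← Real.rpow_add (by norm_num),
          add_neg_cancel, Real.rpow_zero, one_mul]
    _ ≤ 2 ^ M * bracket k ^ (-M) := by
        gcongr 2 ^ M * ?_
        exact Real.rpow_le_rpow_of_nonpos (bracket_pos k) h (neg_nonpos.2 hM)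

lemma bracket_rpow_neg_le_rpow_two_sub (M : ℝ) (k : Wave) :
    bracket k ^ (-M) ≤ bracket k ^ (2 - M) :=
  Real.rpow_le_rpow_of_exponent_le (one_le_bracket k) (by linarith)

lemma sum_triple_products_bracket_le {M : ℝ} (hM : 0 ≤ M) {k₁ k₂ x y : Wave}
    (h : ‖x‖ ^ 2 + ‖y‖ ^ 2 = ‖k₁‖ ^ 2 + ‖k₂‖ ^ 2) :
    bracket k₂ ^ (-M) * bracket x ^ (-M) * bracket y ^ (-M) +
      bracket k₁ ^ (-M) * bracket x ^ (-M) * bracket y ^ (-M) +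
      bracket k₁ ^ (-M) * bracket k₂ ^ (-M) * bracket y ^ (-M) +
      bracket k₁ ^ (-M) * bracket k₂ ^ (-M) * bracket x ^ (-M) ≤
    (2 * 2 ^ M + 1) * (bracket k₁ ^ (-M) *
      (bracket k₂ ^ (-M) * (bracket x ^ (-M) + bracket y ^ (-M)))) := by
  have hnonneg (k : Wave) : 0 ≤ bracket k ^ (-M) := Real.rpow_nonneg (bracket_pos k).le _
  rcases le_total ‖y‖ ‖x‖ with hyx | hxy
  · obtain ⟨h₁, h₂⟩ := bracket_le_two_mul_bracket h hyx
    exact sum_triple_products_le (hnonneg _) (hnonneg _) (hnonneg _) (hnonneg _) (by positivity)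
      (bracket_rpow_neg_le_of_le_two_mul hM h₁) (bracket_rpow_neg_le_of_le_two_mul hM h₂)
  · obtain ⟨h₁, h₂⟩ := bracket_le_two_mul_bracket ((add_comm _ _).trans h) hxy
    linarith [sum_triple_products_le (hnonneg k₁) (hnonneg k₂) (hnonneg y) (hnonneg x)
      (by positivity) (bracket_rpow_neg_le_of_le_two_mul hM h₁)
      (bracket_rpow_neg_le_of_le_two_mul hM h₂)]

/-- The four wave vectors taking part in the collision of `k₁` with `q = (k₂, σ)`. -/
def quartet (k₁ : Wave) (q : Wave × Sph) : Set Wave :=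
  {k₁, q.1, out₁ k₁ q.1 q.2, out₂ k₁ q.1 q.2}

/-- Gain minus loss of the density `f` in the collision of `k₁` with `q = (k₂, σ)`: the collision
integrand without its kernel. -/
def balance (f : Wave → ℝ) (k₁ : Wave) (q : Wave × Sph) : ℝ :=
  gainLoss (f k₁) (f q.1) (f (out₁ k₁ q.1 q.2)) (f (out₂ k₁ q.1 q.2))

lemma collision_eq (β : ℝ) (f : Wave → ℝ) (k₁ : Wave) :
    collision β f k₁ = (1 / 8) * ∫ q, collisionKernel β k₁ q * balance f k₁ q ∂collisionMeasure :=
  rfl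

lemma measurable_balance {f : Wave → ℝ} (hf : Measurable f) (k₁ : Wave) :
    Measurable (balance f k₁) := by
  unfold balance gainLoss
  fun_prop

lemma forall_mem_quartet {P : Wave → Prop} {k₁ : Wave} {q : Wave × Sph} :
    (∀ k ∈ quartet k₁ q, P k) ↔
      P k₁ ∧ P q.1 ∧ P (out₁ k₁ q.1 q.2) ∧ P (out₂ k₁ q.1 q.2) := by
  simp [quartet]

lemma nonneg_of_abs_le_mul_bracket_rpow {a G p : ℝ} {k : Wave} (h : |a| ≤ G * bracket k ^ p) :
    0 ≤ G :=
  nonneg_of_mul_nonneg_left ((abs_nonneg a).trans h) (Real.rpow_pos_of_pos (bracket_pos k) p)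

lemma abs_balance_sub_balance_le {M G ε : ℝ} (hM : 0 ≤ M) {f g : Wave → ℝ} {k₁ : Wave}
    {q : Wave × Sph}
    (h : ∀ k ∈ quartet k₁ q, |f k| ≤ G * bracket k ^ (-M) ∧ |g k| ≤ G * bracket k ^ (-M) ∧
      |f k - g k| ≤ ε * bracket k ^ (-M)) :
    |balance f k₁ q - balance g k₁ q| ≤
      3 * ε * G ^ 2 * (2 * 2 ^ M + 1) * (bracket k₁ ^ (-M) * decayWeight M k₁ q) := by
  obtain ⟨h₁, h₂, h₃, h₄⟩ := forall_mem_quartet.1 h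
  have hε : 0 ≤ ε := nonneg_of_abs_le_mul_bracket_rpow h₁.2.2
  have hb₁ := bracket_pos k₁
  have hb₂ := bracket_pos q.1
  have hb₃ := bracket_pos (out₁ k₁ q.1 q.2)
  have hb₄ := bracket_pos (out₂ k₁ q.1 q.2)
  refine (abs_gainLoss_sub_gainLoss_le h₁ h₂ h₃ h₄).trans ?_
  rw [mul_assoc (3 * ε * G ^ 2)]
  gcongr
  refine (sum_triple_products_bracket_le hM (norm_out_sq_add_norm_out_sq k₁ q.1 q.2)).trans ?_
  unfold decayWeight
  gcongr ?_ * (?_ * (?_ * (?_ + ?_))) <;> exact bracket_rpow_neg_le_rpow_two_sub M _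

lemma abs_balance_le {M G : ℝ} (hM : 0 ≤ M) {f : Wave → ℝ} {k₁ : Wave} {q : Wave × Sph}
    (h : ∀ k ∈ quartet k₁ q, |f k| ≤ G * bracket k ^ (-M)) :
    |balance f k₁ q| ≤
      3 * G * G ^ 2 * (2 * 2 ^ M + 1) * bracket k₁ ^ (-M) * decayWeight M k₁ q := by
  have hdiff : ∀ k ∈ quartet k₁ q, |f k| ≤ G * bracket k ^ (-M) ∧
      |(0 : Wave → ℝ) k| ≤ G * bracket k ^ (-M) ∧
      |f k - (0 : Wave → ℝ) k| ≤ G * bracket k ^ (-M) := fun k hk =>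
    ⟨h k hk, by simpa using (abs_nonneg _).trans (h k hk), by simpa using h k hk⟩
  simpa [balance, gainLoss, mul_assoc] using abs_balance_sub_balance_le hM hdiff

lemma integrable_collisionKernel_mul {β M D : ℝ} {k₁ : Wave} {F : Wave × Sph → ℝ}
    (hint : Integrable (fun q => collisionKernel β k₁ q * decayWeight M k₁ q) collisionMeasure)
    (hF : Measurable F) (hle : ∀ᵐ q ∂collisionMeasure, |F q| ≤ D * decayWeight M k₁ q) :
    Integrable (fun q => collisionKernel β k₁ q * F q) collisionMeasure := by
  refine (hint.const_mul D).mono' (by fun_prop) ?_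
  filter_upwards [hle] with q hq
  rw [Real.norm_eq_abs, abs_mul, abs_of_nonneg (collisionKernel_nonneg β k₁ q), mul_left_comm]
  exact mul_le_mul_of_nonneg_left hq (collisionKernel_nonneg β k₁ q)

lemma integrable_collisionKernel_mul_balance {β M G : ℝ} (hM : 0 ≤ M) {k₁ : Wave} {f : Wave → ℝ}
    (hint : Integrable (fun q => collisionKernel β k₁ q * decayWeight M k₁ q) collisionMeasure)
    (hf : Measurable f)
    (hle : ∀ᵐ q ∂collisionMeasure, ∀ k ∈ quartet k₁ q, |f k| ≤ G * bracket k ^ (-M)) :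
    Integrable (fun q => collisionKernel β k₁ q * balance f k₁ q) collisionMeasure :=
  integrable_collisionKernel_mul hint (measurable_balance hf k₁)
    (hle.mono fun _ hq => abs_balance_le hM hq)

lemma ae_ae_add_comp {P : Wave → Prop} (hP : ∀ᵐ k : Wave, P k) {v : Wave × Sph → Wave}
    (hv : Measurable v) :
    ∀ᵐ k₁ : Wave, ∀ᵐ q ∂collisionMeasure, P (k₁ + v (q.1 - k₁, q.2)) := by
  obtain ⟨s, hs, hsm, hs₀⟩ := exists_measurable_superset_of_null (mem_ae_iff.1 hP)
  have hmeas : MeasurableSet {p : (Wave × Sph) × Wave | p.2 + v p.1 ∈ sᶜ} :=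
    hsm.compl.preimage (by fun_prop)
  have shifted : ∀ᵐ q ∂collisionMeasure, ∀ᵐ k₁ : Wave, k₁ + v q ∈ sᶜ :=
    Eventually.of_forall fun q =>
      (measurePreserving_add_right volume (v q)).quasiMeasurePreserving.ae
        (p := fun k => k ∈ sᶜ) (compl_mem_ae_iff.2 hs₀)
  filter_upwards [(Measure.ae_ae_comm hmeas).1 shifted] with k₁ hk₁
  have hmp : MeasurePreserving (Prod.map (fun k : Wave => k - k₁) (id : Sph → Sph))
      collisionMeasure collisionMeasure :=
    (measurePreserving_sub_right volume k₁).prod (MeasurePreserving.id surface)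
  filter_upwards [hmp.quasiMeasurePreserving.ae hk₁] with q hq
  by_contra hc
  exact hq (hs hc)

lemma ae_ae_forall_mem_quartet {P : Wave → Prop} (hP : ∀ᵐ k : Wave, P k) :
    ∀ᵐ k₁ : Wave, ∀ᵐ q ∂collisionMeasure, ∀ k ∈ quartet k₁ q, P k := by
  have h₃ := ae_ae_add_comp hP (v := fun q => (1 / 2 : ℝ) • q.1 + (‖q.1‖ / 2) • (q.2 : Wave))
    (by fun_prop)
  have h₄ := ae_ae_add_comp hP (v := fun q => (1 / 2 : ℝ) • q.1 - (‖q.1‖ / 2) • (q.2 : Wave))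
    (by fun_prop)
  filter_upwards [hP, h₃, h₄] with k₁ hk₁ hk₃ hk₄
  filter_upwards [Measure.quasiMeasurePreserving_fst.ae hP, hk₃, hk₄] with q hq₂ hq₃ hq₄
  have hout₁ : out₁ k₁ q.1 q.2 =
      k₁ + ((1 / 2 : ℝ) • (q.1 - k₁) + (‖q.1 - k₁‖ / 2) • (q.2 : Wave)) := by
    rw [out₁, norm_sub_rev]
    module
  have hout₂ : out₂ k₁ q.1 q.2 =
      k₁ + ((1 / 2 : ℝ) • (q.1 - k₁) - (‖q.1 - k₁‖ / 2) • (q.2 : Wave)) := by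
    rw [out₂, norm_sub_rev]
    module
  exact forall_mem_quartet.2 ⟨hk₁, hq₂, hout₁ ▸ hq₃, hout₂ ▸ hq₄⟩

theorem exists_abs_collision_sub_collision_le {β M : ℝ} (hβ : 0 ≤ β) (hM : 6 + 4 * β < M) :
    ∃ K : ℝ, 0 < K ∧ ∀ (G ε : ℝ) (f g : Wave → ℝ), Measurable f → Measurable g →
      (∀ᵐ k : Wave, |f k| ≤ G * bracket k ^ (-M) ∧ |g k| ≤ G * bracket k ^ (-M) ∧
        |f k - g k| ≤ ε * bracket k ^ (-M)) →
      ∀ᵐ k : Wave, |collision β f k - collision β g k| ≤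
        ε * G ^ 2 * K * bracket k ^ (4 * β - 1 - M) := by
  obtain ⟨K, hK, hKint⟩ := exists_integral_collisionKernel_mul_decayWeight_le hβ hM
  have hM₀ : 0 ≤ M := by linarith
  refine ⟨3 * (2 * 2 ^ M + 1) * K, by positivity, fun G ε f g hf hg h => ?_⟩
  filter_upwards [h, ae_ae_forall_mem_quartet h] with k₁ hk₁ hquartet
  have hε : 0 ≤ ε := nonneg_of_abs_le_mul_bracket_rpow hk₁.2.2
  obtain ⟨hint, hle⟩ := hKint k₁
  have hb := bracket_pos k₁
  have hintf := integrable_collisionKernel_mul_balance hM₀ hint hf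
    (hquartet.mono fun q hq k hk => (hq k hk).1)
  have hintg := integrable_collisionKernel_mul_balance hM₀ hint hg
    (hquartet.mono fun q hq k hk => (hq k hk).2.1)
  set D := 3 * ε * G ^ 2 * (2 * 2 ^ M + 1) * bracket k₁ ^ (-M) with hD
  have integrand_le : ∀ᵐ q ∂collisionMeasure,
      ‖collisionKernel β k₁ q * balance f k₁ q - collisionKernel β k₁ q * balance g k₁ q‖ ≤
        D * (collisionKernel β k₁ q * decayWeight M k₁ q) := by
    filter_upwards [hquartet] with q hq
    have hkernel := collisionKernel_nonneg β k₁ q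
    rw [← mul_sub, norm_mul, Real.norm_of_nonneg hkernel, Real.norm_eq_abs, mul_left_comm]
    refine mul_le_mul_of_nonneg_left ?_ hkernel
    simpa only [hD, mul_assoc] using abs_balance_sub_balance_le hM₀ hq
  calc |collision β f k₁ - collision β g k₁|
      = 1 / 8 * ‖∫ q, collisionKernel β k₁ q * balance f k₁ q -
          collisionKernel β k₁ q * balance g k₁ q ∂collisionMeasure‖ := by
        rw [collision_eq, collision_eq, ← mul_sub, ← integral_sub hintf hintg, abs_mul,
          abs_of_pos (by norm_num : (0 : ℝ) < 1 / 8), Real.norm_eq_abs]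
    _ ≤ 1 * (D * (K * bracket k₁ ^ (4 * β - 1))) := by
        gcongr
        · norm_num
        · refine (norm_integral_le_of_norm_le (hint.const_mul D) integrand_le).trans ?_
          rw [integral_const_mul]
          gcongr
    _ = ε * G ^ 2 * (3 * (2 * 2 ^ M + 1) * K) * bracket k₁ ^ (4 * β - 1 - M) := by
        rw [hD, sub_eq_add_neg (4 * β - 1), Real.rpow_add hb]
        ring

lemma two_mul_norm_le_norm_sub_add_norm_add {E : Type*} [SeminormedAddCommGroup E]
    [NormedSpace ℝ E] (x y : E) : 2 * ‖x‖ ≤ ‖x - y‖ + ‖x + y‖ := by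
  have h := norm_add_le (x - y) (x + y)
  rwa [sub_add_add_cancel, ← two_smul ℝ x, norm_smul, Real.norm_ofNat] at h

lemma abs_norm_add_sub_norm_sub_le {E : Type*} [SeminormedAddCommGroup E] (x y : E) :
    |‖x + y‖ - ‖x - y‖| ≤ 2 * ‖y‖ := by
  have h := abs_norm_sub_norm_le (x + y) (x - y)
  rw [add_sub_sub_cancel] at h
  linarith [norm_add_le y y]

lemma sub_sub_two_div_le_integral_one_sub_cos {ω : ℝ} (hω : 0 < ω) (x y : ℝ) :
    y - x - 2 / ω ≤ ∫ s in x..y, (1 - Real.cos (ω * s)) := by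
  rw [intervalIntegral.integral_sub (by simp) (Continuous.intervalIntegrable (by fun_prop) _ _),
    integral_one, intervalIntegral.integral_comp_mul_left _ hω.ne', integral_cos, smul_eq_mul,
    inv_mul_eq_div]
  gcongr
  linarith [Real.sin_le_one (ω * y), Real.neg_one_le_sin (ω * x)]

lemma norm_out₁_sq {k₁ k₂ e : Wave} (he : k₁ + k₂ = ‖k₁ + k₂‖ • e) (σ : Sph) :
    ‖out₁ k₁ k₂ σ‖ ^ 2 = ‖k₁ - k₂‖ * ‖k₁ + k₂‖ / 2 * inner ℝ e (σ : Wave) +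
      (‖k₁ - k₂‖ ^ 2 + ‖k₁ + k₂‖ ^ 2) / 4 := by
  have hout : out₁ k₁ k₂ σ = (1 / 2 : ℝ) • (k₁ + k₂ - (-‖k₁ - k₂‖) • (σ : Wave)) := by
    rw [out₁]
    module
  rw [hout, norm_smul, mul_pow, norm_sub_smul_sq he (norm_coe_sph σ),
    Real.norm_of_nonneg (by norm_num)]
  ring

-- `‖out₁‖²` is an affine function of the height above the plane orthogonal to `k₁ + k₂`, so by
-- Archimedes' theorem it is uniformly distributed.
lemma lintegral_surface_norm_out₁_sq {k₁ k₂ : Wave} (h : 0 < ‖k₁ - k₂‖ * ‖k₁ + k₂‖)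
    {φ : ℝ → ℝ≥0∞} (hφ : Measurable φ) :
    ∫⁻ σ : Sph, φ (‖out₁ k₁ k₂ σ‖ ^ 2) ∂surface =
      ENNReal.ofReal (4 * π / (‖k₁ - k₂‖ * ‖k₁ + k₂‖)) *
        ∫⁻ t in Set.Icc (((‖k₁ - k₂‖ - ‖k₁ + k₂‖) / 2) ^ 2) (((‖k₁ - k₂‖ + ‖k₁ + k₂‖) / 2) ^ 2),
          φ t := by
  obtain ⟨e, he, hsum⟩ := exists_norm_eq_one_and_eq_norm_smul (k₁ + k₂)
  simp only [norm_out₁_sq hsum]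
  set u := ‖k₁ - k₂‖
  set v := ‖k₁ + k₂‖
  set a := (u ^ 2 + v ^ 2) / 4
  set b := u * v / 2 with hb
  have hu : u ≠ 0 := left_ne_zero_of_mul h.ne'
  have hv : v ≠ 0 := right_ne_zero_of_mul h.ne'
  have hb₀ : 0 < b := by positivity
  have himage : Set.Icc (((u - v) / 2) ^ 2) (((u + v) / 2) ^ 2) =
      (fun s => b * s + a) '' Set.Icc (-1) 1 := by
    rw [Set.image_affine_Icc' hb₀]
    congr 1 <;> ring
  rw [lintegral_surface_inner he (φ := fun s => φ (b * s + a)) (by fun_prop), himage,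
    lintegral_image_eq_lintegral_abs_deriv_mul measurableSet_Icc (f' := fun _ => b)
      (fun s _ => by
        simpa using (((hasDerivAt_id s).const_mul b).add_const a).hasDerivWithinAt)
      (fun s _ t _ hst => by simpa [hb₀.ne'] using hst),
    lintegral_const_mul' _ _ ENNReal.ofReal_ne_top, ← mul_assoc,
    ← ENNReal.ofReal_mul (by positivity), abs_of_pos hb₀]
  congr 2
  rw [hb]
  field_simp
  norm_num

/-- The collisions of `k₁` in which `k₂` and the second outgoing wave vector are of order one: the
part of the collision integral in which the oscillation of the datum is felt. -/
def resonantSet (k₁ : Wave) : Set (Wave × Sph) :=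
  {q | ‖q.1‖ ∈ Set.Icc (1 / 2) 1 ∧ ‖out₂ k₁ q.1 q.2‖ ^ 2 ∈ Set.Icc 1 2}

lemma measurableSet_resonantSet (k₁ : Wave) : MeasurableSet (resonantSet k₁) :=
  (measurableSet_Icc.preimage (by fun_prop : Measurable fun q : Wave × Sph => ‖q.1‖)).inter
    (measurableSet_Icc.preimage
      (by fun_prop : Measurable fun q : Wave × Sph => ‖out₂ k₁ q.1 q.2‖ ^ 2))

/-- The amount by which `cos (N * ‖k‖ ^ 2)` falls short of a crest at the first outgoing wave
vector, restricted to `resonantSet k₁`. -/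
def oscillation (N : ℝ) (k₁ : Wave) : Wave × Sph → ℝ :=
  (resonantSet k₁).indicator fun q => 1 - Real.cos (N * ‖out₁ k₁ q.1 q.2‖ ^ 2)

lemma oscillation_nonneg (N : ℝ) (k₁ : Wave) (q : Wave × Sph) : 0 ≤ oscillation N k₁ q :=
  Set.indicator_nonneg (fun _ _ => sub_nonneg.2 (Real.cos_le_one _)) _

lemma measurable_oscillation (N : ℝ) (k₁ : Wave) : Measurable (oscillation N k₁) :=
  Measurable.indicator (by fun_prop) (measurableSet_resonantSet k₁)

lemma oscillation_eq_indicator {N : ℝ} {k₁ k₂ : Wave} (hk₂ : ‖k₂‖ ∈ Set.Icc (1 / 2) 1) (σ : Sph) :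
    oscillation N k₁ (k₂, σ) =
      (Set.Icc (‖k₁‖ ^ 2 + ‖k₂‖ ^ 2 - 2) (‖k₁‖ ^ 2 + ‖k₂‖ ^ 2 - 1)).indicator
        (fun t => 1 - Real.cos (N * t)) (‖out₁ k₁ k₂ σ‖ ^ 2) := by
  have hmem : (k₂, σ) ∈ resonantSet k₁ ↔ ‖out₁ k₁ k₂ σ‖ ^ 2 ∈
      Set.Icc (‖k₁‖ ^ 2 + ‖k₂‖ ^ 2 - 2) (‖k₁‖ ^ 2 + ‖k₂‖ ^ 2 - 1) := by
    simp only [resonantSet, Set.mem_ofPred_eq, hk₂, true_and]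
    rw [← norm_out_sq_add_norm_out_sq k₁ k₂ σ, Set.mem_Icc, Set.mem_Icc]
    constructor <;> rintro ⟨_, _⟩ <;> constructor <;> linarith
  by_cases h : (k₂, σ) ∈ resonantSet k₁
  · rw [oscillation, Set.indicator_of_mem h, Set.indicator_of_mem (hmem.1 h)]
  · rw [oscillation, Set.indicator_of_notMem h, Set.indicator_of_notMem (mt hmem.2 h)]

lemma le_lintegral_surface_oscillation {N : ℝ} (hN : 4 ≤ N) {k₁ k₂ : Wave} (hk₁ : 2 ≤ ‖k₁‖)
    (hk₂ : ‖k₂‖ ∈ Set.Icc (1 / 2) 1) :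
    ENNReal.ofReal (2 * π / (‖k₁ - k₂‖ * ‖k₁ + k₂‖)) ≤
      ∫⁻ σ : Sph, ENNReal.ofReal (oscillation N k₁ (k₂, σ)) ∂surface := by
  set a := ‖k₁‖ ^ 2 + ‖k₂‖ ^ 2 with ha
  have hsum := two_mul_norm_le_norm_sub_add_norm_add k₁ k₂
  have hdiff := abs_le.1 (abs_norm_add_sub_norm_sub_le k₁ k₂)
  have hk₂' := hk₂.2
  have hu : 0 < ‖k₁ - k₂‖ := by linarith
  have hv : 0 < ‖k₁ + k₂‖ := by linarith
  have hsub : Set.Icc (a - 2) (a - 1) ⊆ Set.Icc (((‖k₁ - k₂‖ - ‖k₁ + k₂‖) / 2) ^ 2)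
      (((‖k₁ - k₂‖ + ‖k₁ + k₂‖) / 2) ^ 2) := Set.Icc_subset_Icc (by nlinarith) (by nlinarith)
  have mean_ge : ENNReal.ofReal (1 / 2) ≤
      ∫⁻ t in Set.Icc (a - 2) (a - 1), ENNReal.ofReal (1 - Real.cos (N * t)) := by
    rw [← ofReal_integral_eq_lintegral_ofReal (Continuous.integrableOn_Icc (by fun_prop))
      (Eventually.of_forall fun t => sub_nonneg.2 (Real.cos_le_one _)),
      integral_Icc_eq_integral_Ioc, ← intervalIntegral.integral_of_le (by linarith)]
    refine ENNReal.ofReal_le_ofReal (le_trans ?_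
      (sub_sub_two_div_le_integral_one_sub_cos (by linarith) _ _))
    have : 2 / N ≤ 2 / 4 := by gcongr
    linarith
  calc ENNReal.ofReal (2 * π / (‖k₁ - k₂‖ * ‖k₁ + k₂‖))
      = ENNReal.ofReal (4 * π / (‖k₁ - k₂‖ * ‖k₁ + k₂‖)) * ENNReal.ofReal (1 / 2) := by
        rw [← ENNReal.ofReal_mul (by positivity)]
        ring_nf
    _ ≤ ENNReal.ofReal (4 * π / (‖k₁ - k₂‖ * ‖k₁ + k₂‖)) *
          ∫⁻ t in Set.Icc (a - 2) (a - 1), ENNReal.ofReal (1 - Real.cos (N * t)) := by gcongr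
    _ = ∫⁻ σ : Sph, (Set.Icc (a - 2) (a - 1)).indicator
          (fun t => ENNReal.ofReal (1 - Real.cos (N * t))) (‖out₁ k₁ k₂ σ‖ ^ 2) ∂surface := by
        rw [lintegral_surface_norm_out₁_sq (by positivity)
          (Measurable.indicator (by fun_prop) measurableSet_Icc),
          setLIntegral_indicator measurableSet_Icc, Set.inter_eq_left.2 hsub]
    _ = _ := by
        refine lintegral_congr fun σ => ?_
        rw [oscillation_eq_indicator hk₂, ← ha]
        simp only [Set.indicator_apply, apply_ite ENNReal.ofReal, ENNReal.ofReal_zero]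

lemma le_collisionKernel_of_mem_resonantSet {β : ℝ} (hβ : 0 ≤ β) {k₁ : Wave} (hk₁ : 2 ≤ ‖k₁‖)
    {k₂ : Wave} {σ : Sph} (hq : (k₂, σ) ∈ resonantSet k₁) :
    ‖k₁‖ ^ (4 * β) / 4 ^ (2 * β) * ‖k₁ - k₂‖ ≤ collisionKernel β k₁ (k₂, σ) := by
  obtain ⟨⟨hk₂, -⟩, hk₄, hk₄'⟩ := hq
  dsimp only at hk₂ hk₄ hk₄'
  have henergy := norm_out_sq_add_norm_out_sq k₁ k₂ σ
  have hk₃ : ‖k₁‖ / 2 ≤ ‖out₁ k₁ k₂ σ‖ := le_of_sq_le_sq (by nlinarith) (norm_nonneg _)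
  have hk₄ : 1 ≤ ‖out₂ k₁ k₂ σ‖ := le_of_sq_le_sq (by linarith) (norm_nonneg _)
  refine mul_le_mul_of_nonneg_right ?_ (norm_nonneg _)
  calc ‖k₁‖ ^ (4 * β) / 4 ^ (2 * β) = (‖k₁‖ * (1 / 2) * (‖k₁‖ / 2) * 1) ^ (2 * β) := by
        rw [show ‖k₁‖ * (1 / 2) * (‖k₁‖ / 2) * 1 = ‖k₁‖ ^ (2 : ℝ) / 4 by
          rw [Real.rpow_two]; ring, Real.div_rpow (by positivity) (by norm_num),
          ← Real.rpow_mul (by positivity)]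
        ring_nf
    _ ≤ (‖k₁‖ * ‖k₂‖ * ‖out₁ k₁ k₂ σ‖ * ‖out₂ k₁ k₂ σ‖) ^ (2 * β) := by gcongr

lemma volume_norm_mem_Icc_pos_lt_top {E : Type*} [NormedAddCommGroup E] [NormedSpace ℝ E]
    [Nontrivial E] [FiniteDimensional ℝ E] [MeasurableSpace E] [BorelSpace E] (μ : Measure E)
    [μ.IsAddHaarMeasure] {r R : ℝ} (hr : 0 ≤ r) (hrR : r < R) :
    0 < μ {k : E | ‖k‖ ∈ Set.Icc r R} ∧ μ {k : E | ‖k‖ ∈ Set.Icc r R} < ⊤ := by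
  obtain ⟨x, hx⟩ := exists_norm_eq E (show 0 ≤ (r + R) / 2 by linarith)
  have hopen : IsOpen {k : E | ‖k‖ ∈ Set.Ioo r R} := isOpen_Ioo.preimage continuous_norm
  have hball : {k : E | ‖k‖ ∈ Set.Icc r R} ⊆ Metric.closedBall 0 R := fun k hk => by
    simpa using hk.2
  refine ⟨?_, (measure_mono hball).trans_lt measure_closedBall_lt_top⟩
  refine (hopen.measure_pos μ ⟨x, ?_⟩).trans_le
    (measure_mono fun k hk => Set.Ioo_subset_Icc_self hk)
  simp only [Set.mem_ofPred_eq, hx]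
  constructor <;> linarith

lemma le_lintegral_surface_collisionKernel_mul_oscillation {β N : ℝ} (hβ : 0 ≤ β) (hN : 4 ≤ N)
    {k₁ k₂ : Wave} (hk₁ : 2 ≤ ‖k₁‖) (hk₂ : ‖k₂‖ ∈ Set.Icc (1 / 2) 1) :
    ENNReal.ofReal (π / 4 ^ (2 * β) * ‖k₁‖ ^ (4 * β - 1)) ≤ ∫⁻ σ : Sph,
      ENNReal.ofReal (collisionKernel β k₁ (k₂, σ) * oscillation N k₁ (k₂, σ)) ∂surface := by
  have hdiff := norm_sub_norm_le k₁ k₂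
  have hsum := norm_add_le k₁ k₂
  have hsum' := norm_sub_le_norm_add k₁ k₂
  have hk₂' := hk₂.2
  have hu : 0 < ‖k₁ - k₂‖ := by linarith
  have hv : 0 < ‖k₁ + k₂‖ := by linarith
  have hk₀ : 0 < ‖k₁‖ := by linarith
  calc ENNReal.ofReal (π / 4 ^ (2 * β) * ‖k₁‖ ^ (4 * β - 1))
      ≤ ENNReal.ofReal (‖k₁‖ ^ (4 * β) / 4 ^ (2 * β) * ‖k₁ - k₂‖) *
          ENNReal.ofReal (2 * π / (‖k₁ - k₂‖ * ‖k₁ + k₂‖)) := by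
        rw [← ENNReal.ofReal_mul (by positivity)]
        refine ENNReal.ofReal_le_ofReal ?_
        calc π / 4 ^ (2 * β) * ‖k₁‖ ^ (4 * β - 1)
            = ‖k₁‖ ^ (4 * β) / 4 ^ (2 * β) * (2 * π / (2 * ‖k₁‖)) := by
              rw [Real.rpow_sub_one hk₀.ne']
              field_simp
          _ ≤ ‖k₁‖ ^ (4 * β) / 4 ^ (2 * β) * (2 * π / ‖k₁ + k₂‖) := by
              gcongr
              linarith
          _ = _ := by field_simp
    _ ≤ ENNReal.ofReal (‖k₁‖ ^ (4 * β) / 4 ^ (2 * β) * ‖k₁ - k₂‖) *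
          ∫⁻ σ : Sph, ENNReal.ofReal (oscillation N k₁ (k₂, σ)) ∂surface := by
        gcongr
        exact le_lintegral_surface_oscillation hN hk₁ hk₂
    _ = ∫⁻ σ : Sph, ENNReal.ofReal (‖k₁‖ ^ (4 * β) / 4 ^ (2 * β) * ‖k₁ - k₂‖ *
          oscillation N k₁ (k₂, σ)) ∂surface := by
        simp_rw [ENNReal.ofReal_mul (show 0 ≤ ‖k₁‖ ^ (4 * β) / 4 ^ (2 * β) * ‖k₁ - k₂‖ by
          positivity)]
        rw [lintegral_const_mul' _ _ ENNReal.ofReal_ne_top]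
    _ ≤ _ := by
        refine lintegral_mono fun σ => ENNReal.ofReal_le_ofReal ?_
        by_cases hq : (k₂, σ) ∈ resonantSet k₁
        · exact mul_le_mul_of_nonneg_right (le_collisionKernel_of_mem_resonantSet hβ hk₁ hq)
            (oscillation_nonneg N k₁ _)
        · simp only [oscillation, Set.indicator_of_notMem hq, mul_zero, le_refl]

theorem exists_le_integral_collisionKernel_mul_oscillation {β : ℝ} (hβ : 0 ≤ β) :
    ∃ c : ℝ, 0 < c ∧ ∀ (N : ℝ) (k₁ : Wave), 4 ≤ N → 2 ≤ ‖k₁‖ →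
      Integrable (fun q => collisionKernel β k₁ q * oscillation N k₁ q) collisionMeasure →
      c * ‖k₁‖ ^ (4 * β - 1) ≤ ∫ q, collisionKernel β k₁ q * oscillation N k₁ q
        ∂collisionMeasure := by
  set Q : Set Wave := {k | ‖k‖ ∈ Set.Icc (1 / 2) 1}
  have hQ : MeasurableSet Q := measurableSet_Icc.preimage measurable_norm
  obtain ⟨hQ₀, hQtop⟩ : 0 < volume Q ∧ volume Q < ⊤ :=
    volume_norm_mem_Icc_pos_lt_top volume (by norm_num) (by norm_num)
  refine ⟨π / 4 ^ (2 * β) * (volume Q).toReal,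
    mul_pos (by positivity) (ENNReal.toReal_pos hQ₀.ne' hQtop.ne), fun N k₁ hN hk₁ hint => ?_⟩
  have hnonneg (q : Wave × Sph) : 0 ≤ collisionKernel β k₁ q * oscillation N k₁ q :=
    mul_nonneg (collisionKernel_nonneg β k₁ q) (oscillation_nonneg N k₁ q)
  have hmeas := measurable_oscillation N k₁
  rw [← ENNReal.ofReal_le_ofReal_iff (integral_nonneg hnonneg),
    ofReal_integral_eq_lintegral_ofReal hint (Eventually.of_forall hnonneg),
    lintegral_prod _ (by fun_prop)]
  calc ENNReal.ofReal (π / 4 ^ (2 * β) * (volume Q).toReal * ‖k₁‖ ^ (4 * β - 1))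
      = ∫⁻ _ in Q, ENNReal.ofReal (π / 4 ^ (2 * β) * ‖k₁‖ ^ (4 * β - 1)) := by
        rw [setLIntegral_const, mul_right_comm, ENNReal.ofReal_mul (by positivity),
          ENNReal.ofReal_toReal hQtop.ne]
    _ ≤ ∫⁻ k₂ in Q, ∫⁻ σ : Sph,
          ENNReal.ofReal (collisionKernel β k₁ (k₂, σ) * oscillation N k₁ (k₂, σ)) ∂surface :=
        setLIntegral_mono' hQ fun k₂ hk₂ =>
          le_lintegral_surface_collisionKernel_mul_oscillation hβ hN hk₁ hk₂
    _ ≤ _ := setLIntegral_le_lintegral _ _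

lemma le_decayWeight_of_mem_resonantSet {M : ℝ} (hM : 2 ≤ M) {k₁ : Wave} {q : Wave × Sph}
    (hq : q ∈ resonantSet k₁) : (2 : ℝ) ^ (2 - M) * 2 ^ (2 - M) ≤ decayWeight M k₁ q := by
  obtain ⟨⟨-, hk₂⟩, -, hk₄⟩ := hq
  have hb₂ := bracket_pos q.1
  have hb₃ := bracket_pos (out₁ k₁ q.1 q.2)
  have le_rpow (k : Wave) (hk : ‖k‖ ^ 2 ≤ 2) : (2 : ℝ) ^ (2 - M) ≤ bracket k ^ (2 - M) := by
    refine Real.rpow_le_rpow_of_nonpos (bracket_pos k) ?_ (by linarith)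
    refine le_of_sq_le_sq ?_ (by norm_num)
    rw [bracket_sq]
    linarith
  refine mul_le_mul (le_rpow _ ?_) ?_ (by positivity) (by positivity)
  · nlinarith [norm_nonneg q.1]
  · exact (le_rpow _ hk₄).trans (le_add_of_nonneg_left (by positivity))

lemma integrable_collisionKernel_mul_oscillation {β M N : ℝ} (hM : 2 ≤ M) {k₁ : Wave}
    (hint : Integrable (fun q => collisionKernel β k₁ q * decayWeight M k₁ q) collisionMeasure) :
    Integrable (fun q => collisionKernel β k₁ q * oscillation N k₁ q) collisionMeasure := by
  refine integrable_collisionKernel_mul (D := 2 * (2 ^ (2 - M) * 2 ^ (2 - M))⁻¹) hint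
    (measurable_oscillation N k₁) (Eventually.of_forall fun q => ?_)
  rw [abs_of_nonneg (oscillation_nonneg _ _ _)]
  by_cases hq : q ∈ resonantSet k₁
  · calc oscillation N k₁ q ≤ 2 * 1 := by
          rw [oscillation, Set.indicator_of_mem hq]
          linarith [Real.neg_one_le_cos (N * ‖out₁ k₁ q.1 q.2‖ ^ 2)]
      _ ≤ 2 * ((2 ^ (2 - M) * 2 ^ (2 - M))⁻¹ * decayWeight M k₁ q) := by
          gcongr
          rw [inv_mul_eq_div]
          exact (one_le_div (by positivity)).2 (le_decayWeight_of_mem_resonantSet hM hq)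
      _ = _ := (mul_assoc _ _ _).symm
  · rw [oscillation, Set.indicator_of_notMem hq]
    have := decayWeight_nonneg M k₁ q
    positivity

/-- The envelope of the oscillating datum. It is comparable to `⟨k⟩^(-M)`, but it is a function of
`‖k‖ ^ 4`. -/
def profile (M : ℝ) (k : Wave) : ℝ := (1 + ‖k‖ ^ 4) ^ (-(M / 4))

lemma profile_pos (M : ℝ) (k : Wave) : 0 < profile M k := by
  unfold profile
  positivity

lemma bracket_rpow_neg_eq (M : ℝ) (k : Wave) :
    bracket k ^ (-M) = ((1 + ‖k‖ ^ 2) ^ 2) ^ (-(M / 4)) := by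
  rw [← bracket_sq, ← pow_mul, ← Real.rpow_natCast, ← Real.rpow_mul (bracket_pos k).le]
  congr 1
  push_cast
  ring

lemma bracket_rpow_two_sub_eq (M : ℝ) (k : Wave) :
    bracket k ^ (2 - M) = bracket k ^ (-M) * bracket k ^ 2 := by
  rw [← Real.rpow_two, ← Real.rpow_add (bracket_pos k), neg_add_eq_sub]

lemma bracket_rpow_neg_le_profile {M : ℝ} (hM : 0 ≤ M) (k : Wave) :
    bracket k ^ (-M) ≤ profile M k := by
  rw [bracket_rpow_neg_eq, profile]
  exact Real.rpow_le_rpow_of_nonpos (by positivity) (by nlinarith [sq_nonneg ‖k‖]) (by linarith)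

lemma profile_le_bracket_rpow_neg {M : ℝ} (hM : 0 ≤ M) (k : Wave) :
    profile M k ≤ 2 ^ (M / 4) * bracket k ^ (-M) := by
  calc profile M k ≤ ((1 + ‖k‖ ^ 2) ^ 2 / 2) ^ (-(M / 4)) :=
        Real.rpow_le_rpow_of_nonpos (by positivity) (by nlinarith [sq_nonneg (‖k‖ ^ 2 - 1)])
          (by linarith)
    _ = 2 ^ (M / 4) * bracket k ^ (-M) := by
        rw [bracket_rpow_neg_eq, Real.div_rpow (by positivity) (by norm_num),
          Real.rpow_neg (x := 2) (by norm_num)]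
        field_simp

lemma abs_rpow_neg_one_add_sq_sub_le {m x y : ℝ} (hm : 0 ≤ m) (hx : 0 < x) (hy : x / 2 ≤ y) :
    |(1 + y ^ 2) ^ (-m) - (1 + x ^ 2) ^ (-m)| ≤
      4 * m * 4 ^ m * ((1 + x ^ 2) ^ (-m) / x) * |y - x| := by
  have hderiv : ∀ z ∈ Set.Ici (x / 2), HasDerivWithinAt (fun z : ℝ => (1 + z ^ 2) ^ (-m))
      ((2 * z) * (-m) * (1 + z ^ 2) ^ (-m - 1)) (Set.Ici (x / 2)) z := by
    intro z _
    have h : HasDerivAt (fun z : ℝ => 1 + z ^ 2) (2 * z) z := by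
      simpa using (hasDerivAt_pow 2 z).const_add 1
    exact (h.rpow_const (Or.inl (by positivity))).hasDerivWithinAt
  have norm_deriv_le : ∀ z ∈ Set.Ici (x / 2), ‖(2 * z) * (-m) * (1 + z ^ 2) ^ (-m - 1)‖ ≤
      4 * m * 4 ^ m * ((1 + x ^ 2) ^ (-m) / x) := by
    intro z hz
    rw [Set.mem_Ici] at hz
    have hz₀ : 0 < z := by linarith
    have hpow : (1 + z ^ 2) ^ (-m) ≤ 4 ^ m * (1 + x ^ 2) ^ (-m) := by
      calc (1 + z ^ 2) ^ (-m) ≤ ((1 + x ^ 2) / 4) ^ (-m) :=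
            Real.rpow_le_rpow_of_nonpos (by positivity) (by nlinarith) (by linarith)
        _ = 4 ^ m * (1 + x ^ 2) ^ (-m) := by
            rw [Real.div_rpow (by positivity) (by norm_num), Real.rpow_neg (x := 4) (by norm_num)]
            field_simp
    have hquot : z / (1 + z ^ 2) ≤ 2 / x := by
      rw [div_le_div_iff₀ (by positivity) hx]
      nlinarith
    rw [Real.norm_eq_abs, abs_mul, abs_mul, abs_neg, abs_of_nonneg hm, abs_of_pos (by positivity),
      abs_of_pos (by positivity), Real.rpow_sub_one (by positivity)]
    calc 2 * z * m * ((1 + z ^ 2) ^ (-m) / (1 + z ^ 2))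
        = 2 * m * ((z / (1 + z ^ 2)) * (1 + z ^ 2) ^ (-m)) := by ring
      _ ≤ 2 * m * ((2 / x) * (4 ^ m * (1 + x ^ 2) ^ (-m))) := by gcongr
      _ = 4 * m * 4 ^ m * ((1 + x ^ 2) ^ (-m) / x) := by ring
  exact (convex_Ici (x / 2)).norm_image_sub_le_of_norm_hasDerivWithin_le hderiv norm_deriv_le
    (show x / 2 ≤ x by linarith) hy

lemma abs_profile_sub_profile_le {M : ℝ} (hM : 0 ≤ M) {k x : Wave} (hk : 1 ≤ ‖k‖)
    (hx : ‖k‖ ^ 2 / 2 ≤ ‖x‖ ^ 2) :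
    |profile M x - profile M k| ≤
      2 * M * 4 ^ (M / 4) * (profile M k / bracket k ^ 2) * |‖x‖ ^ 2 - ‖k‖ ^ 2| := by
  have h := abs_rpow_neg_one_add_sq_sub_le (m := M / 4) (by positivity) (by positivity) hx
  rw [← pow_mul, ← pow_mul] at h
  have hb : bracket k ^ 2 / 2 ≤ ‖k‖ ^ 2 := by
    rw [bracket_sq]
    nlinarith
  have hp := profile_pos M k
  have hb₀ := bracket_pos k
  refine h.trans ?_
  gcongr ?_ * _
  calc 4 * (M / 4) * 4 ^ (M / 4) * (profile M k / ‖k‖ ^ 2)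
      ≤ 4 * (M / 4) * 4 ^ (M / 4) * (profile M k / (bracket k ^ 2 / 2)) := by gcongr
    _ = 2 * M * 4 ^ (M / 4) * (profile M k / bracket k ^ 2) := by field_simp

lemma profile_mul_profile_mul_le {M : ℝ} (hM : 0 ≤ M) (k y : Wave) :
    profile M k * profile M y * (1 + (‖k‖ ^ 2 + ‖y‖ ^ 2)) ≤
      (2 ^ (M / 4)) ^ 2 * (bracket k ^ (2 - M) * bracket y ^ (2 - M)) := by
  have hbk := bracket_pos k
  have hby := bracket_pos y
  have hpy := profile_pos M y
  have hsum : 1 + (‖k‖ ^ 2 + ‖y‖ ^ 2) ≤ bracket k ^ 2 * bracket y ^ 2 := by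
    rw [bracket_sq, bracket_sq]
    nlinarith [mul_nonneg (sq_nonneg ‖k‖) (sq_nonneg ‖y‖)]
  calc profile M k * profile M y * (1 + (‖k‖ ^ 2 + ‖y‖ ^ 2))
      ≤ (2 ^ (M / 4) * bracket k ^ (-M)) * (2 ^ (M / 4) * bracket y ^ (-M)) *
          (bracket k ^ 2 * bracket y ^ 2) := by
        gcongr <;> exact profile_le_bracket_rpow_neg hM _
    _ = _ := by
        rw [bracket_rpow_two_sub_eq, bracket_rpow_two_sub_eq]
        ring

lemma profile_mul_profile_out_le {M : ℝ} (hM : 2 ≤ M) {k₁ k₂ x : Wave} (y : Wave)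
    (h₁ : bracket k₁ ≤ 2 * bracket x) (h₂ : bracket k₂ ≤ 2 * bracket x) :
    profile M x * profile M y ≤ (2 ^ (M / 4)) ^ 2 * 2 ^ M *
      (bracket k₂ ^ (2 - M) * bracket y ^ (2 - M)) / bracket k₁ ^ 2 := by
  have hb₁ := bracket_pos k₁
  have hb₂ := bracket_pos k₂
  have hbx := bracket_pos x
  have hby := bracket_pos y
  have gain₁ := bracket_rpow_neg_le_of_le_two_mul (M := 2) (by norm_num) h₁
  have gain₂ := bracket_rpow_neg_le_of_le_two_mul (M := M - 2) (by linarith) h₂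
  rw [neg_sub] at gain₂
  have hx : bracket x ^ (-M) = bracket x ^ (-2 : ℝ) * bracket x ^ (2 - M) := by
    rw [← Real.rpow_add hbx]
    ring_nf
  have htwo : (2 : ℝ) ^ M = 2 ^ (2 : ℝ) * 2 ^ (M - 2) := by
    rw [← Real.rpow_add (by norm_num), add_sub_cancel]
  calc profile M x * profile M y
      ≤ (2 ^ (M / 4) * bracket x ^ (-M)) * (2 ^ (M / 4) * bracket y ^ (-M)) := by
        have := profile_pos M y
        gcongr <;> exact profile_le_bracket_rpow_neg (by linarith) _
    _ ≤ (2 ^ (M / 4) * ((2 ^ (2 : ℝ) * bracket k₁ ^ (-2 : ℝ)) *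
          (2 ^ (M - 2) * bracket k₂ ^ (2 - M)))) * (2 ^ (M / 4) * bracket y ^ (2 - M)) := by
        rw [hx]
        have := bracket_rpow_neg_le_rpow_two_sub M y
        gcongr
    _ = _ := by
        rw [htwo, Real.rpow_neg hb₁.le, Real.rpow_two, Real.rpow_two]
        ring

lemma datum_eq (M A : ℝ) (N : ℕ) (k : Wave) :
    datum M A N k = (A + Real.cos (N * ‖k‖ ^ 2)) * profile M k := by
  rw [datum, profile, Real.rpow_neg (by positivity), div_eq_mul_inv]

lemma measurable_datum (M A : ℝ) (N : ℕ) : Measurable (datum M A N) := by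
  unfold datum
  fun_prop

lemma datum_le {M A : ℝ} (hA : 1 ≤ A) (N : ℕ) (k : Wave) :
    datum M A N k ≤ 2 * A * profile M k := by
  rw [datum_eq]
  have := profile_pos M k
  gcongr
  linarith [Real.cos_le_one (N * ‖k‖ ^ 2)]

lemma le_datum {M A : ℝ} (hA : 2 ≤ A) (N : ℕ) (k : Wave) :
    A / 2 * profile M k ≤ datum M A N k := by
  rw [datum_eq]
  have := profile_pos M k
  gcongr
  linarith [Real.neg_one_le_cos (N * ‖k‖ ^ 2)]

lemma datum_pos {M A : ℝ} (hA : 2 ≤ A) (N : ℕ) (k : Wave) : 0 < datum M A N k :=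
  (mul_pos (by linarith) (profile_pos M k)).trans_le (le_datum hA N k)

lemma abs_datum_le {M A : ℝ} (hM : 0 ≤ M) (hA : 2 ≤ A) (N : ℕ) (k : Wave) :
    |datum M A N k| ≤ 2 * A * 2 ^ (M / 4) * bracket k ^ (-M) := by
  rw [abs_of_pos (datum_pos hA N k), mul_assoc]
  exact (datum_le (by linarith) N k).trans
    (mul_le_mul_of_nonneg_left (profile_le_bracket_rpow_neg hM k) (by linarith))

lemma datum_sub_datum_le {M A η s : ℝ} (hM : 0 ≤ M) (hA : 1 ≤ A) {N : ℕ} {k x : Wave}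
    (hk : 1 ≤ ‖k‖) (hcos : 1 - η ≤ Real.cos (N * ‖k‖ ^ 2)) (hx : ‖k‖ ^ 2 / 2 ≤ ‖x‖ ^ 2)
    (hs : |‖x‖ ^ 2 - ‖k‖ ^ 2| ≤ s) :
    datum M A N x - datum M A N k ≤ profile M k *
      (2 * A * (2 * M * 4 ^ (M / 4)) / bracket k ^ 2 * s + η - (1 - Real.cos (N * ‖x‖ ^ 2))) := by
  have hp := profile_pos M k
  have hb := bracket_pos k
  have hcos_ge := Real.neg_one_le_cos (N * ‖x‖ ^ 2)
  have hcos_le := Real.cos_le_one (N * ‖x‖ ^ 2)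
  rw [datum_eq, datum_eq]
  set c := Real.cos (N * ‖x‖ ^ 2)
  have hprofile : (A + c) * (profile M x - profile M k) ≤
      2 * A * (2 * M * 4 ^ (M / 4) * (profile M k / bracket k ^ 2) * s) := by
    calc (A + c) * (profile M x - profile M k)
        ≤ (A + c) * |profile M x - profile M k| := by
          gcongr
          · linarith
          · exact le_abs_self _
      _ ≤ 2 * A * (2 * M * 4 ^ (M / 4) * (profile M k / bracket k ^ 2) * s) := by
          gcongr
          · linarith
          · exact (abs_profile_sub_profile_le hM hk hx).trans (by gcongr)
  have hphase : profile M k * (c - Real.cos (N * ‖k‖ ^ 2)) ≤ profile M k * (η - (1 - c)) :=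
    mul_le_mul_of_nonneg_left (by linarith) hp.le
  calc (A + c) * profile M x - (A + Real.cos (N * ‖k‖ ^ 2)) * profile M k
      = (A + c) * (profile M x - profile M k) +
          profile M k * (c - Real.cos (N * ‖k‖ ^ 2)) := by ring
    _ ≤ _ := add_le_add hprofile hphase
    _ = _ := by ring

lemma datum_mul_datum_mul_sub_le {M A η : ℝ} (hM : 0 ≤ M) (hA : 2 ≤ A) (hη : 0 ≤ η) {N : ℕ}
    {k₁ k₂ x y : Wave} (hk₁ : 1 ≤ ‖k₁‖) (hcos : 1 - η ≤ Real.cos (N * ‖k₁‖ ^ 2))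
    (h : ‖x‖ ^ 2 + ‖y‖ ^ 2 = ‖k₁‖ ^ 2 + ‖k₂‖ ^ 2) (hyx : ‖y‖ ≤ ‖x‖) :
    datum M A N k₂ * datum M A N y * (datum M A N x - datum M A N k₁) ≤ profile M k₁ *
      (4 * A ^ 2 * (2 * A * (2 * M * 4 ^ (M / 4)) / bracket k₁ ^ 2 + η) *
          ((2 ^ (M / 4)) ^ 2 * (bracket k₂ ^ (2 - M) * bracket y ^ (2 - M))) -
        datum M A N k₂ * datum M A N y * (1 - Real.cos (N * ‖x‖ ^ 2))) := by
  have hyx₂ : ‖y‖ ^ 2 ≤ ‖x‖ ^ 2 := by gcongr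
  set s := ‖k₂‖ ^ 2 + ‖y‖ ^ 2
  have hshift : |‖x‖ ^ 2 - ‖k₁‖ ^ 2| ≤ s :=
    abs_le.2 ⟨by nlinarith [sq_nonneg ‖k₂‖], by nlinarith [sq_nonneg ‖y‖]⟩
  have hdiff := datum_sub_datum_le (A := A) hM (by linarith) hk₁ hcos
    (by nlinarith [sq_nonneg ‖k₂‖]) hshift
  have hprofile := profile_mul_profile_mul_le hM k₂ y
  have hp₁ := profile_pos M k₁
  have hp₂ := profile_pos M k₂
  have hpy := profile_pos M y
  have hb₁ := bracket_pos k₁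
  have hf₂ := datum_pos (M := M) hA N k₂
  have hfy := datum_pos (M := M) hA N y
  set B := 2 * A * (2 * M * 4 ^ (M / 4)) / bracket k₁ ^ 2
  have hB : 0 ≤ B := by positivity
  have main : datum M A N k₂ * datum M A N y * (B * s + η) ≤ 4 * A ^ 2 * (B + η) *
      ((2 ^ (M / 4)) ^ 2 * (bracket k₂ ^ (2 - M) * bracket y ^ (2 - M))) :=
    calc datum M A N k₂ * datum M A N y * (B * s + η)
        ≤ (2 * A * profile M k₂) * (2 * A * profile M y) * ((B + η) * (1 + s)) := by
          gcongr
          · exact datum_le (by linarith) N k₂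
          · exact datum_le (by linarith) N y
          · nlinarith [mul_nonneg hη (by positivity : 0 ≤ s)]
      _ = 4 * A ^ 2 * (B + η) * (profile M k₂ * profile M y * (1 + s)) := by ring
      _ ≤ _ := by gcongr
  calc _ ≤ datum M A N k₂ * datum M A N y *
        (profile M k₁ * (B * s + η - (1 - Real.cos (N * ‖x‖ ^ 2)))) := by gcongr
    _ = profile M k₁ * (datum M A N k₂ * datum M A N y * (B * s + η) -
          datum M A N k₂ * datum M A N y * (1 - Real.cos (N * ‖x‖ ^ 2))) := by ring
    _ ≤ _ := by gcongr

lemma datum_mul_datum_mul_datum_le {M A : ℝ} (hM : 2 ≤ M) (hA : 2 ≤ A) (N : ℕ)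
    {k₁ k₂ x y : Wave} (h : ‖x‖ ^ 2 + ‖y‖ ^ 2 = ‖k₁‖ ^ 2 + ‖k₂‖ ^ 2) (hyx : ‖y‖ ≤ ‖x‖) :
    datum M A N k₁ * datum M A N x * datum M A N y ≤ profile M k₁ * (8 * A ^ 3 *
      ((2 ^ (M / 4)) ^ 2 * 2 ^ M * (bracket k₂ ^ (2 - M) * bracket y ^ (2 - M)) /
        bracket k₁ ^ 2)) := by
  obtain ⟨h₁, h₂⟩ := bracket_le_two_mul_bracket h hyx
  have hp₁ := profile_pos M k₁
  have hpx := profile_pos M x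
  have hfx := datum_pos (M := M) hA N x
  have hfy := datum_pos (M := M) hA N y
  calc datum M A N k₁ * datum M A N x * datum M A N y
      ≤ (2 * A * profile M k₁) * (2 * A * profile M x) * (2 * A * profile M y) := by
        gcongr <;> exact datum_le (by linarith) N _
    _ = profile M k₁ * (8 * A ^ 3 * (profile M x * profile M y)) := by ring
    _ ≤ _ := by
        gcongr
        exact profile_mul_profile_out_le hM y h₁ h₂

-- The loss term `f₁ f₂ f_x` has a sign, and `f₂ f_y (f_x - f₁)` is negative up to small errors
-- because `k₁` sits at a crest of the oscillation.
lemma exists_gainLoss_datum_le {M : ℝ} (hM : 2 ≤ M) :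
    ∃ C : ℝ, 0 < C ∧ ∀ (A η : ℝ) (N : ℕ) (k₁ k₂ x y : Wave), 2 ≤ A → 0 ≤ η → 1 ≤ ‖k₁‖ →
      1 - η ≤ Real.cos (N * ‖k₁‖ ^ 2) → ‖x‖ ^ 2 + ‖y‖ ^ 2 = ‖k₁‖ ^ 2 + ‖k₂‖ ^ 2 → ‖y‖ ≤ ‖x‖ →
      gainLoss (datum M A N k₁) (datum M A N k₂) (datum M A N x) (datum M A N y) ≤
        profile M k₁ * (C * (A ^ 2 * η + A ^ 3 / bracket k₁ ^ 2) *
            (bracket k₂ ^ (2 - M) * bracket y ^ (2 - M)) -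
          datum M A N k₂ * datum M A N y * (1 - Real.cos (N * ‖x‖ ^ 2))) := by
  set H := ((2 : ℝ) ^ (M / 4)) ^ 2
  set D := 2 * M * 4 ^ (M / 4) + (2 : ℝ) ^ M with hD
  refine ⟨H * (4 + 8 * D), by positivity, fun A η N k₁ k₂ x y hA hη hk₁ hcos h hyx => ?_⟩
  have hb₁ := bracket_pos k₁
  have hb₂ := bracket_pos k₂
  have hby := bracket_pos y
  have hp₁ := profile_pos M k₁
  set E := bracket k₂ ^ (2 - M) * bracket y ^ (2 - M)
  have hloss : 0 ≤ datum M A N k₁ * datum M A N k₂ * datum M A N x :=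
    (mul_pos (mul_pos (datum_pos hA N _) (datum_pos hA N _)) (datum_pos hA N _)).le
  have hcrest := datum_mul_datum_mul_sub_le (M := M) (by linarith) hA hη hk₁ hcos h hyx
  have hgain := datum_mul_datum_mul_datum_le hM hA N h hyx
  have hcoeff : 4 * A ^ 2 * (2 * A * (2 * M * 4 ^ (M / 4)) / bracket k₁ ^ 2 + η) * (H * E) +
      8 * A ^ 3 * (H * 2 ^ M * E / bracket k₁ ^ 2) ≤
      H * (4 + 8 * D) * (A ^ 2 * η + A ^ 3 / bracket k₁ ^ 2) * E := by
    have hextra : 0 ≤ H * E * (8 * D * (A ^ 2 * η) + 4 * (A ^ 3 / bracket k₁ ^ 2)) := by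
      positivity
    rw [hD] at hextra ⊢
    linear_combination hextra
  have := mul_le_mul_of_nonneg_left hcoeff hp₁.le
  unfold gainLoss
  linarith

lemma mul_oscillation_le_datum_mul_datum {M A : ℝ} (hM : 0 ≤ M) (hA : 2 ≤ A) (N : ℕ) (k₁ : Wave)
    (q : Wave × Sph) :
    (5 ^ (-(M / 4)) / 2) ^ 2 * A ^ 2 * oscillation N k₁ q ≤
      datum M A N q.1 * datum M A N (out₂ k₁ q.1 q.2) *
        (1 - Real.cos (N * ‖out₁ k₁ q.1 q.2‖ ^ 2)) := by
  have hf₂ := datum_pos (M := M) hA N q.1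
  have hf₄ := datum_pos (M := M) hA N (out₂ k₁ q.1 q.2)
  have hcos : 0 ≤ 1 - Real.cos (N * ‖out₁ k₁ q.1 q.2‖ ^ 2) := sub_nonneg.2 (Real.cos_le_one _)
  by_cases hq : q ∈ resonantSet k₁
  · have datum_ge (k : Wave) (hk : ‖k‖ ^ 2 ≤ 2) : A / 2 * 5 ^ (-(M / 4)) ≤ datum M A N k := by
      refine le_trans ?_ (le_datum hA N k)
      gcongr
      exact Real.rpow_le_rpow_of_nonpos (by positivity) (by nlinarith [sq_nonneg ‖k‖])
        (by linarith)
    have hk₂ : ‖q.1‖ ^ 2 ≤ 2 := by nlinarith [hq.1.2, norm_nonneg q.1]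
    rw [oscillation, Set.indicator_of_mem hq]
    refine mul_le_mul_of_nonneg_right ?_ hcos
    calc ((5 : ℝ) ^ (-(M / 4)) / 2) ^ 2 * A ^ 2
        = (A / 2 * 5 ^ (-(M / 4))) * (A / 2 * 5 ^ (-(M / 4))) := by ring
      _ ≤ _ := mul_le_mul (datum_ge _ hk₂) (datum_ge _ hq.2.2) (by positivity) hf₂.le
  · rw [oscillation, Set.indicator_of_notMem hq, mul_zero]
    positivity

lemma oscillation_eq_zero (N : ℝ) {k₁ : Wave} (hk₁ : 2 ≤ ‖k₁‖) {q : Wave × Sph}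
    (h : ‖out₁ k₁ q.1 q.2‖ ≤ ‖out₂ k₁ q.1 q.2‖) : oscillation N k₁ q = 0 := by
  refine Set.indicator_of_notMem (fun hq => ?_) _
  have henergy := norm_out_sq_add_norm_out_sq k₁ q.1 q.2
  have hsq : ‖out₁ k₁ q.1 q.2‖ ^ 2 ≤ ‖out₂ k₁ q.1 q.2‖ ^ 2 := by gcongr
  nlinarith [hq.1.1, hq.2.2]

lemma gainLoss_swap (f₁ f₂ f₃ f₄ : ℝ) : gainLoss f₁ f₂ f₃ f₄ = gainLoss f₁ f₂ f₄ f₃ := by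
  unfold gainLoss
  ring

lemma exists_balance_datum_le {M : ℝ} (hM : 2 ≤ M) :
    ∃ c C : ℝ, 0 < c ∧ 0 < C ∧ ∀ (A η : ℝ) (N : ℕ) (k₁ : Wave) (q : Wave × Sph), 2 ≤ A → 0 ≤ η →
      2 ≤ ‖k₁‖ → 1 - η ≤ Real.cos (N * ‖k₁‖ ^ 2) →
      balance (datum M A N) k₁ q ≤
        profile M k₁ * (C * (A ^ 2 * η + A ^ 3 / bracket k₁ ^ 2) * decayWeight M k₁ q -
          c * A ^ 2 * oscillation N k₁ q) := by
  obtain ⟨C, hC, hgainLoss⟩ := exists_gainLoss_datum_le hM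
  refine ⟨(5 ^ (-(M / 4)) / 2) ^ 2, C, by positivity, hC, fun A η N k₁ q hA hη hk₁ hcos => ?_⟩
  have hp₁ := profile_pos M k₁
  have hb₁ := bracket_pos k₁
  have hb₂ := bracket_pos q.1
  have hb₃ := bracket_pos (out₁ k₁ q.1 q.2)
  have hb₄ := bracket_pos (out₂ k₁ q.1 q.2)
  have henergy := norm_out_sq_add_norm_out_sq k₁ q.1 q.2
  rcases le_total ‖out₂ k₁ q.1 q.2‖ ‖out₁ k₁ q.1 q.2‖ with hle | hle
  · refine (hgainLoss A η N k₁ q.1 _ _ hA hη (by linarith) hcos henergy hle).trans ?_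
    gcongr profile M k₁ * (_ * ?_ - ?_)
    · exact mul_le_mul_of_nonneg_left (le_add_of_nonneg_left (by positivity)) (by positivity)
    · exact mul_oscillation_le_datum_mul_datum (by linarith) hA N k₁ q
  · have hf₂ := datum_pos (M := M) hA N q.1
    have hf₃ := datum_pos (M := M) hA N (out₁ k₁ q.1 q.2)
    rw [balance, gainLoss_swap, oscillation_eq_zero N hk₁ hle]
    refine (hgainLoss A η N k₁ q.1 _ _ hA hη (by linarith) hcos
      ((add_comm _ _).trans henergy) hle).trans ?_
    gcongr profile M k₁ * (_ * ?_ - ?_)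
    · exact mul_le_mul_of_nonneg_left (le_add_of_nonneg_right (by positivity)) (by positivity)
    · rw [mul_zero]
      exact mul_nonneg (by positivity) (sub_nonneg.2 (Real.cos_le_one _))

lemma bracket_le_two_mul_norm {k : Wave} (hk : 1 ≤ ‖k‖) : bracket k ≤ 2 * ‖k‖ := by
  refine le_of_sq_le_sq ?_ (by positivity)
  rw [bracket_sq]
  nlinarith

lemma bracket_rpow_le_two_rpow_mul {p : ℝ} (hp : 0 ≤ p) {k : Wave} (hk : 1 ≤ ‖k‖) :
    bracket k ^ p ≤ 2 ^ p * ‖k‖ ^ p := by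
  rw [← Real.mul_rpow (by norm_num) (norm_nonneg _)]
  exact Real.rpow_le_rpow (bracket_pos k).le (bracket_le_two_mul_norm hk) hp

lemma integral_mul_le_of_le_mul_sub {α : Type*} [MeasurableSpace α] {μ : Measure α}
    {κ b w o : α → ℝ} {p δ ε : ℝ} (hκ : ∀ q, 0 ≤ κ q) (hb : Integrable (fun q => κ q * b q) μ)
    (hw : Integrable (fun q => κ q * w q) μ) (ho : Integrable (fun q => κ q * o q) μ)
    (hle : ∀ q, b q ≤ p * (δ * w q - ε * o q)) :
    ∫ q, κ q * b q ∂μ ≤ p * (δ * ∫ q, κ q * w q ∂μ - ε * ∫ q, κ q * o q ∂μ) := by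
  calc ∫ q, κ q * b q ∂μ ≤ ∫ q, p * (δ * (κ q * w q) - ε * (κ q * o q)) ∂μ := by
        refine integral_mono hb (((hw.const_mul δ).sub (ho.const_mul ε)).const_mul p) fun q => ?_
        refine (mul_le_mul_of_nonneg_left (hle q) (hκ q)).trans (le_of_eq ?_)
        ring
    _ = p * (δ * ∫ q, κ q * w q ∂μ - ε * ∫ q, κ q * o q ∂μ) := by
        rw [integral_const_mul, integral_sub (hw.const_mul δ) (ho.const_mul ε),
          integral_const_mul, integral_const_mul]

lemma exists_integral_collisionKernel_mul_balance_datum_le {β M : ℝ} (hβ : 1 / 4 ≤ β)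
    (hM : 6 + 4 * β < M) :
    ∃ c C : ℝ, 0 < c ∧ 0 < C ∧ ∀ (A η : ℝ) (N : ℕ) (k₁ : Wave), 2 ≤ A → 0 ≤ η → 4 ≤ N →
      2 ≤ ‖k₁‖ → 1 - η ≤ Real.cos (N * ‖k₁‖ ^ 2) →
      ∫ q, collisionKernel β k₁ q * balance (datum M A N) k₁ q ∂collisionMeasure ≤
        profile M k₁ * ((C * (A ^ 2 * η + A ^ 3 / bracket k₁ ^ 2) - c * A ^ 2) *
          ‖k₁‖ ^ (4 * β - 1)) := by
  obtain ⟨c₀, C₀, hc₀, hC₀, hbalance⟩ := exists_balance_datum_le (M := M) (by linarith)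
  obtain ⟨K, hK, hKint⟩ :=
    exists_integral_collisionKernel_mul_decayWeight_le (β := β) (by linarith) hM
  obtain ⟨c₁, hc₁, hosc⟩ :=
    exists_le_integral_collisionKernel_mul_oscillation (β := β) (by linarith)
  refine ⟨c₀ * c₁, C₀ * (K * 2 ^ (4 * β - 1)), by positivity, by positivity,
    fun A η N k₁ hA hη hN hk₁ hcos => ?_⟩
  obtain ⟨hint, hle⟩ := hKint k₁
  have hp₁ := profile_pos M k₁
  have hb₁ := bracket_pos k₁
  have hM₀ : 0 ≤ M := by linarith
  have hint_osc : Integrable (fun q => collisionKernel β k₁ q * oscillation N k₁ q)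
    collisionMeasure := integrable_collisionKernel_mul_oscillation (by linarith) hint
  have hint_balance := integrable_collisionKernel_mul_balance hM₀ hint (measurable_datum M A N)
    (Eventually.of_forall fun q k _ => abs_datum_le hM₀ hA N k)
  have hosc_ge := hosc N k₁ (by exact_mod_cast hN) hk₁ hint_osc
  set P := ‖k₁‖ ^ (4 * β - 1)
  set δ := C₀ * (A ^ 2 * η + A ^ 3 / bracket k₁ ^ 2) with hδ
  have hbracket : bracket k₁ ^ (4 * β - 1) ≤ 2 ^ (4 * β - 1) * P :=
    bracket_rpow_le_two_rpow_mul (by linarith) (by linarith)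
  calc ∫ q, collisionKernel β k₁ q * balance (datum M A N) k₁ q ∂collisionMeasure
      ≤ profile M k₁ * (δ * ∫ q, collisionKernel β k₁ q * decayWeight M k₁ q ∂collisionMeasure -
          c₀ * A ^ 2 * ∫ q, collisionKernel β k₁ q * oscillation N k₁ q ∂collisionMeasure) :=
        integral_mul_le_of_le_mul_sub (collisionKernel_nonneg β k₁) hint_balance hint hint_osc
          fun q => hbalance A η N k₁ q hA hη hk₁ hcos
    _ ≤ profile M k₁ * (δ * (K * (2 ^ (4 * β - 1) * P)) - c₀ * A ^ 2 * (c₁ * P)) := by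
        gcongr
        exact hle.trans (by gcongr)
    _ = _ := by
        rw [hδ]
        ring

lemma two_mul_norm_rpow_neg_le_profile {M : ℝ} (hM : 0 ≤ M) {k : Wave} (hk : 1 ≤ ‖k‖) :
    (2 * ‖k‖) ^ (-M) ≤ profile M k :=
  (Real.rpow_le_rpow_of_nonpos (bracket_pos k) (bracket_le_two_mul_norm hk) (by linarith)).trans
    (bracket_rpow_neg_le_profile hM k)

lemma two_rpow_neg_mul_norm_rpow_le {M : ℝ} (hM : 0 ≤ M) (p : ℝ) {k : Wave} (hk : 1 ≤ ‖k‖) :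
    2 ^ (-M) * ‖k‖ ^ (p - M) ≤ ‖k‖ ^ p * profile M k := by
  have hk₀ : 0 < ‖k‖ := by linarith
  calc 2 ^ (-M) * ‖k‖ ^ (p - M) = ‖k‖ ^ p * (2 * ‖k‖) ^ (-M) := by
        rw [Real.mul_rpow (by norm_num) hk₀.le, sub_eq_add_neg, Real.rpow_add hk₀]
        ring
    _ ≤ ‖k‖ ^ p * profile M k := by
        gcongr
        exact two_mul_norm_rpow_neg_le_profile hM hk

theorem exists_collision_datum_le {β M : ℝ} (hβ : 1 / 4 ≤ β) (hM : 6 + 4 * β < M) :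
    ∃ c η : ℝ, 0 < c ∧ 0 < η ∧ ∀ A : ℝ, 2 ≤ A → ∃ R : ℝ, ∀ (N : ℕ) (k : Wave), 4 ≤ N → R ≤ ‖k‖ →
      1 - η ≤ Real.cos (N * ‖k‖ ^ 2) →
      collision β (datum M A N) k ≤ -(c * A ^ 2 * ‖k‖ ^ (4 * β - 1 - M)) := by
  obtain ⟨c, C, hc, hC, hle⟩ := exists_integral_collisionKernel_mul_balance_datum_le hβ hM
  set η := c / (4 * C) with hη
  have hη₀ : 0 < η := by positivity
  refine ⟨2 ^ (-M) * c / 16, η, by positivity, hη₀, fun A hA =>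
    ⟨max 2 (A / η), fun N k hN hR hcos => ?_⟩⟩
  have hk : 2 ≤ ‖k‖ := (le_max_left _ _).trans hR
  have hb := bracket_pos k
  have hM₀ : 0 ≤ M := by linarith
  set P := ‖k‖ ^ (4 * β - 1)
  have remainder_le : A ^ 3 / bracket k ^ 2 ≤ A ^ 2 * η := by
    have hAη : A / η ≤ bracket k ^ 2 := by
      rw [bracket_sq]
      nlinarith [(le_max_right _ _).trans hR]
    rw [div_le_iff₀ hη₀] at hAη
    rw [div_le_iff₀ (by positivity)]
    nlinarith [sq_nonneg A]
  have coeff_le : C * (A ^ 2 * η + A ^ 3 / bracket k ^ 2) - c * A ^ 2 ≤ -(c / 2 * A ^ 2) := by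
    have hCη : C * η = c / 4 := by
      rw [hη]
      field_simp
    nlinarith [mul_le_mul_of_nonneg_left remainder_le hC.le]
  have hp := profile_pos M k
  calc collision β (datum M A N) k
      = 1 / 8 * ∫ q, collisionKernel β k q * balance (datum M A N) k q ∂collisionMeasure :=
        collision_eq _ _ _
    _ ≤ 1 / 8 * (profile M k * (-(c / 2 * A ^ 2) * P)) := by
        refine mul_le_mul_of_nonneg_left ((hle A η N k hA hη₀.le hN hk hcos).trans ?_)
          (by norm_num)
        gcongr
    _ = -(c / 16 * A ^ 2 * (P * profile M k)) := by ring
    _ ≤ -(c / 16 * A ^ 2 * (2 ^ (-M) * ‖k‖ ^ (4 * β - 1 - M))) := by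
        gcongr -(_ * ?_)
        exact two_rpow_neg_mul_norm_rpow_le hM₀ _ (by linarith)
    _ = -(2 ^ (-M) * c / 16 * A ^ 2 * ‖k‖ ^ (4 * β - 1 - M)) := by ring

lemma ae_abs_le_of_wNorm_le {M ε : ℝ} (hε : 0 ≤ ε) {f : Wave → ℝ}
    (h : wNorm M f ≤ ENNReal.ofReal ε) : ∀ᵐ k : Wave, |f k| ≤ ε * bracket k ^ (-M) := by
  rw [wNorm, eLpNorm_exponent_top] at h
  filter_upwards [ae_le_eLpNormEssSup (f := fun k => bracket k ^ M * f k) (μ := volume)] with k hk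
  have hb := bracket_pos k
  replace hk := hk.trans h
  rw [Real.enorm_eq_ofReal_abs, ENNReal.ofReal_le_ofReal_iff hε, abs_mul,
    abs_of_pos (by positivity)] at hk
  rwa [Real.rpow_neg hb.le, ← div_eq_mul_inv, le_div_iff₀' (by positivity)]

lemma MemW.exists_ae_abs_le {M : ℝ} {f : Wave → ℝ} (hf : MemW M f) :
    ∃ G : ℝ, 0 ≤ G ∧ ∀ᵐ k : Wave, |f k| ≤ G * bracket k ^ (-M) :=
  ⟨(wNorm M f).toReal, ENNReal.toReal_nonneg,
    ae_abs_le_of_wNorm_le ENNReal.toReal_nonneg (ENNReal.ofReal_toReal hf.2.ne).ge⟩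

lemma memW_of_abs_le {M G : ℝ} {f : Wave → ℝ} (hf : Measurable f)
    (h : ∀ k, |f k| ≤ G * bracket k ^ (-M)) : MemW M f := by
  refine memLp_top_of_bound (by fun_prop) G (Eventually.of_forall fun k => ?_)
  have hb := bracket_pos k
  have hk := h k
  rw [Real.rpow_neg hb.le, ← div_eq_mul_inv, le_div_iff₀' (by positivity)] at hk
  rwa [Real.norm_eq_abs, abs_mul, abs_of_pos (by positivity)]

lemma MemW.const_mul {M : ℝ} {f : Wave → ℝ} (hf : MemW M f) (r : ℝ) :
    MemW M fun k => r * f k := by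
  have h := MemLp.const_mul hf r
  simpa only [MemW, mul_left_comm] using h

lemma wNorm_const_mul {M r : ℝ} (hr : 0 ≤ r) (f : Wave → ℝ) :
    wNorm M (fun k => r * f k) = ENNReal.ofReal r * wNorm M f := by
  simp only [wNorm, mul_left_comm _ r, ← Real.enorm_of_nonneg hr]
  exact eLpNorm_const_smul r _ _ _

lemma MemW.exists_wNorm_const_mul_eq {M δ : ℝ} {f : Wave → ℝ} (hf : MemW M f)
    (hf₀ : wNorm M f ≠ 0) (hδ : 0 < δ) :
    ∃ r : ℝ, 0 < r ∧ wNorm M (fun k => r * f k) = ENNReal.ofReal δ := by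
  have hpos := ENNReal.toReal_pos hf₀ hf.2.ne
  refine ⟨δ / (wNorm M f).toReal, div_pos hδ hpos, ?_⟩
  rw [wNorm_const_mul (div_pos hδ hpos).le]
  nth_rewrite 2 [← ENNReal.ofReal_toReal (a := wNorm M f) hf.2.ne]
  rw [← ENNReal.ofReal_mul (div_pos hδ hpos).le, div_mul_cancel₀ _ hpos.ne']

lemma measurable_collision_uncurry (β : ℝ) {Ω : Type*} [MeasurableSpace Ω] {f : Ω → Wave → ℝ}
    (hf : Measurable (Function.uncurry f)) :
    Measurable fun p : Ω × Wave => collision β (f p.1) p.2 := by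
  have hintegrand : Measurable fun p : (Ω × Wave) × Wave × Sph =>
      collisionKernel β p.1.2 p.2 * balance (f p.1.1) p.1.2 p.2 := by
    unfold collisionKernel balance gainLoss
    fun_prop
  simp_rw [collision_eq]
  exact hintegrand.stronglyMeasurable.integral_prod_right'.measurable.const_mul _

namespace IsStrongSolution

variable {β M T : ℝ} {f₀ : Wave → ℝ} {f : ℝ → Wave → ℝ}

lemma ae_eq_datum (hf : IsStrongSolution β M T f₀ f) (hT : 0 ≤ T) : ∀ᵐ k : Wave, f 0 k = f₀ k := by
  filter_upwards [hf.duhamel 0 ⟨le_rfl, hT⟩] with k hk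
  simpa using hk.2

lemma exists_forall_ae_abs_sub_le (hf : IsStrongSolution β M T f₀ f) (hT : 0 < T) {ε : ℝ}
    (hε : 0 < ε) :
    ∃ t : ℝ, 0 < t ∧ t ≤ T ∧
      ∀ s ∈ Set.Icc 0 t, ∀ᵐ k : Wave, |f s k - f₀ k| ≤ ε * bracket k ^ (-M) := by
  have hclose : ∀ᶠ s in 𝓝[Set.Icc 0 T] 0, wNorm M (fun k => f s k - f 0 k) < ENNReal.ofReal ε :=
    (hf.continuous 0 ⟨le_rfl, hT.le⟩).eventually_lt_const (ENNReal.ofReal_pos.2 hε)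
  obtain ⟨d, hd, hball⟩ := Metric.mem_nhdsWithin_iff.1 hclose
  refine ⟨min T (d / 2), lt_min hT (by positivity), min_le_left _ _, fun s hs => ?_⟩
  have hsT := hs.2.trans (min_le_left _ _)
  have hsd : s < d := by linarith [hs.2.trans (min_le_right _ _)]
  have hmem : s ∈ Metric.ball 0 d := by
    rwa [Metric.mem_ball, Real.dist_0_eq_abs, abs_of_nonneg hs.1]
  filter_upwards [ae_abs_le_of_wNorm_le hε.le (hball ⟨hmem, hs.1, hsT⟩).le, hf.ae_eq_datum hT.le]
    with k hk hk₀
  rwa [hk₀] at hk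

lemma exists_ae_ae_abs_collision_sub_le (hf : IsStrongSolution β M T f₀ f) (hT : 0 < T)
    (hβ : 0 ≤ β) (hM : 6 + 4 * β < M) (hf₀ : Measurable f₀) {c : ℝ} (hc : 0 < c) :
    ∃ t : ℝ, 0 < t ∧ t ≤ T ∧ (∀ᵐ k : Wave, |f t k - f₀ k| ≤ bracket k ^ (-M)) ∧
      ∀ᵐ k : Wave, ∀ᵐ s ∂volume.restrict (Set.Ioc 0 t),
        |collision β (f s) k - collision β f₀ k| ≤ c * bracket k ^ (4 * β - 1 - M) := by
  obtain ⟨K, hK, hlip⟩ := exists_abs_collision_sub_collision_le hβ hM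
  obtain ⟨G, hG, hbound⟩ := (hf.mem 0 ⟨le_rfl, hT.le⟩).exists_ae_abs_le
  set ε := min 1 (c / ((G + 1) ^ 2 * K))
  have hε₁ : ε ≤ 1 := min_le_left _ _
  have hεc : ε * (G + 1) ^ 2 * K ≤ c := by
    rw [mul_assoc, ← le_div_iff₀ (by positivity)]
    exact min_le_right _ _
  obtain ⟨t, ht, htT, hclose⟩ :=
    hf.exists_forall_ae_abs_sub_le hT (show 0 < ε from lt_min one_pos (by positivity))
  have hcollision : ∀ᵐ s ∂volume.restrict (Set.Ioc 0 t), ∀ᵐ k : Wave,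
      |collision β (f s) k - collision β f₀ k| ≤ c * bracket k ^ (4 * β - 1 - M) := by
    filter_upwards [ae_restrict_mem measurableSet_Ioc] with s hs
    have hbounds : ∀ᵐ k : Wave, |f s k| ≤ (G + 1) * bracket k ^ (-M) ∧
        |f₀ k| ≤ (G + 1) * bracket k ^ (-M) ∧ |f s k - f₀ k| ≤ ε * bracket k ^ (-M) := by
      filter_upwards [hbound, hf.ae_eq_datum hT.le, hclose s ⟨hs.1.le, hs.2⟩] with k hk hk₀ hks
      rw [hk₀] at hk
      have hw : 0 < bracket k ^ (-M) := Real.rpow_pos_of_pos (bracket_pos k) _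
      have hks₁ := hks.trans (mul_le_mul_of_nonneg_right hε₁ hw.le)
      have htriangle := abs_sub_abs_le_abs_sub (f s k) (f₀ k)
      exact ⟨by linarith, by linarith, hks⟩
    filter_upwards [hlip (G + 1) ε (f s) f₀ (hf.measurable.of_uncurry_left) hf₀ hbounds] with k hk
    have hb := bracket_pos k
    exact hk.trans (by gcongr)
  have hmeas : MeasurableSet {p : ℝ × Wave |
      |collision β (f p.1) p.2 - collision β f₀ p.2| ≤ c * bracket p.2 ^ (4 * β - 1 - M)} := by
    have hcoll := measurable_collision_uncurry β hf.measurable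
    have hcoll₀ := measurable_collision_uncurry β (f := fun _ : ℝ => f₀) (hf₀.comp measurable_snd)
    exact measurableSet_le (hcoll.sub hcoll₀).norm (by fun_prop)
  refine ⟨t, ht, htT, ?_, (Measure.ae_ae_comm hmeas).1 hcollision⟩
  filter_upwards [hclose t ⟨ht.le, le_rfl⟩] with k hk
  exact hk.trans (mul_le_of_le_one_left (Real.rpow_nonneg (bracket_pos k).le _) hε₁)

lemma exists_ae_abs_collision_le (hf : IsStrongSolution β M T f₀ f) (hT : 0 < T) (hβ : 0 ≤ β)
    (hM : 6 + 4 * β < M) (hf₀ : Measurable f₀) {c : ℝ} (hc : 0 < c) :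
    ∃ t : ℝ, 0 < t ∧ ∀ᵐ k : Wave,
      |collision β f₀ k| ≤ c * bracket k ^ (4 * β - 1 - M) + t⁻¹ * bracket k ^ (-M) := by
  obtain ⟨t, ht, htT, hdiff, hcollision⟩ :=
    hf.exists_ae_ae_abs_collision_sub_le hT hβ hM hf₀ hc
  refine ⟨t, ht, ?_⟩
  filter_upwards [hdiff, hcollision, hf.duhamel t ⟨ht.le, htT⟩] with k hk hcoll hduhamel
  obtain ⟨hint, hduhamel⟩ := hduhamel
  have hintegral : |∫ s in (0 : ℝ)..t, (collision β (f s) k - collision β f₀ k)| ≤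
      c * bracket k ^ (4 * β - 1 - M) * t := by
    have h := intervalIntegral.norm_integral_le_of_norm_le_const_ae (a := 0) (b := t)
      (f := fun s => collision β (f s) k - collision β f₀ k)
      (by simpa only [Set.uIoc_of_le ht.le, Real.norm_eq_abs] using
        (ae_restrict_iff' measurableSet_Ioc).1 hcoll)
    rwa [sub_zero, abs_of_pos ht] at h
  rw [intervalIntegral.integral_sub hint (by simp), intervalIntegral.integral_const, sub_zero,
    smul_eq_mul, ← sub_eq_of_eq_add' hduhamel] at hintegral
  have hscaled : t * |collision β f₀ k| ≤
      bracket k ^ (-M) + c * bracket k ^ (4 * β - 1 - M) * t := by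
    have h := abs_sub_abs_le_abs_sub (t * collision β f₀ k) (f t k - f₀ k)
    rw [abs_sub_comm _ (f t k - f₀ k), abs_mul, abs_of_pos ht] at h
    linarith
  calc |collision β f₀ k| ≤ (bracket k ^ (-M) + c * bracket k ^ (4 * β - 1 - M) * t) / t :=
        (le_div_iff₀' ht).2 hscaled
    _ = _ := by field_simp; ring

end IsStrongSolution

-- Since `4 * β - 1 > 0`, the bound is a growth faster than the weight `⟨k⟩^(-M)` tolerates.
theorem not_isStrongSolution {β M c T : ℝ} (hβ : 1 / 4 < β) (hM : 6 + 4 * β < M) (hc : 0 < c)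
    {f₀ : Wave → ℝ} (hf₀ : Measurable f₀)
    (h : ∀ R : ℝ, ∃ᵐ k : Wave, R ≤ ‖k‖ ∧ c * ‖k‖ ^ (4 * β - 1 - M) ≤ |collision β f₀ k|)
    (hT : 0 < T) (f : ℝ → Wave → ℝ) : ¬ IsStrongSolution β M T f₀ f := by
  intro hf
  obtain ⟨t, ht, hle⟩ := hf.exists_ae_abs_collision_le hT (by linarith) hM hf₀ (half_pos hc)
  obtain ⟨R, hR⟩ := eventually_atTop.1 ((tendsto_rpow_atTop
    (show 0 < 4 * β - 1 by linarith)).eventually_gt_atTop (t⁻¹ / (c / 2)))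
  obtain ⟨k, ⟨hkR, hlower⟩, hupper⟩ := ((h (max R 1)).and_eventually hle).exists
  have hk : 0 < ‖k‖ := one_pos.trans_le ((le_max_right _ _).trans hkR)
  have rpow_bracket_le {p : ℝ} (hp : p ≤ 0) : bracket k ^ p ≤ ‖k‖ ^ p :=
    Real.rpow_le_rpow_of_nonpos hk (norm_le_bracket k) hp
  have hkM : 0 < ‖k‖ ^ (-M) := by positivity
  have hbound : c * ‖k‖ ^ (4 * β - 1 - M) ≤
      c / 2 * ‖k‖ ^ (4 * β - 1 - M) + t⁻¹ * ‖k‖ ^ (-M) := by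
    refine (hlower.trans hupper).trans ?_
    gcongr c / 2 * ?_ + t⁻¹ * ?_ <;> exact rpow_bracket_le (by linarith)
  rw [sub_eq_add_neg (4 * β - 1), Real.rpow_add hk] at hbound
  have hgrowth : c / 2 * ‖k‖ ^ (4 * β - 1) ≤ t⁻¹ := le_of_mul_le_mul_right (by linarith) hkM
  exact ((le_div_iff₀' (half_pos hc)).2 hgrowth).not_gt (hR ‖k‖ ((le_max_left _ _).trans hkR))

lemma collision_const_mul (β r : ℝ) (f : Wave → ℝ) (k : Wave) :
    collision β (fun k => r * f k) k = r ^ 3 * collision β f k := by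
  rw [collision_eq, collision_eq, mul_left_comm, ← integral_const_mul (r ^ 3)]
  congr 2
  funext q
  unfold balance gainLoss
  ring

lemma memW_datum {M A : ℝ} (hM : 0 ≤ M) (hA : 2 ≤ A) (N : ℕ) : MemW M (datum M A N) :=
  memW_of_abs_le (measurable_datum M A N) (abs_datum_le hM hA N)

lemma wNorm_datum_ne_zero {M A : ℝ} (hA : 2 ≤ A) (N : ℕ) : wNorm M (datum M A N) ≠ 0 := by
  intro h
  have hmeas := measurable_datum M A N
  rw [wNorm, eLpNorm_eq_zero_iff (by fun_prop) ENNReal.top_ne_zero] at h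
  obtain ⟨k, hk⟩ := h.exists
  exact (mul_pos (Real.rpow_pos_of_pos (bracket_pos k) M) (datum_pos hA N k)).ne' hk

lemma cos_mul_norm_sq_eq_one {N : ℝ} (hN : N ≠ 0) {B : ℕ} {k : Wave}
    (hk : ‖k‖ ^ 2 = 2 * π * B / N) : Real.cos (N * ‖k‖ ^ 2) = 1 := by
  rw [hk, mul_div_cancel₀ _ hN, mul_comm, Real.cos_nat_mul_two_pi]

lemma exists_forall_le_norm_of_norm_sq_eq {N : ℝ} (hN : 0 < N) (R : ℝ) :
    ∃ B₀ : ℕ, ∀ B : ℕ, B₀ ≤ B → ∀ k : Wave, ‖k‖ ^ 2 = 2 * π * B / N → R < ‖k‖ := by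
  obtain ⟨B₀, hB₀⟩ := exists_nat_gt (N * R ^ 2 / (2 * π))
  refine ⟨B₀, fun B hB k hk => lt_of_pow_lt_pow_left₀ 2 (norm_nonneg _) ?_⟩
  rw [div_lt_iff₀' (by positivity)] at hB₀
  rw [hk, lt_div_iff₀' hN]
  exact hB₀.trans_le (by gcongr)

lemma frequently_lt_norm_and_lt_cos {N : ℕ} (hN : 0 < N) {η : ℝ} (hη : 0 < η) (R : ℝ) :
    ∃ᵐ k : Wave, R < ‖k‖ ∧ 1 - η < Real.cos (N * ‖k‖ ^ 2) := by
  have hN₀ : (0 : ℝ) < N := by exact_mod_cast hN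
  obtain ⟨B, hB⟩ := exists_forall_le_norm_of_norm_sq_eq hN₀ R
  obtain ⟨k, hk⟩ := exists_norm_eq Wave (Real.sqrt_nonneg (2 * π * B / N))
  have hk₂ : ‖k‖ ^ 2 = 2 * π * B / N := by rw [hk, Real.sq_sqrt (by positivity)]
  have hopen : IsOpen {k : Wave | R < ‖k‖ ∧ 1 - η < Real.cos (N * ‖k‖ ^ 2)} :=
    IsOpen.and (isOpen_lt (by fun_prop) (by fun_prop)) (isOpen_lt (by fun_prop) (by fun_prop))
  refine frequently_ae_iff.2 (hopen.measure_pos volume ⟨k, hB B le_rfl k hk₂, ?_⟩).ne'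
  rw [cos_mul_norm_sq_eq_one hN₀.ne' hk₂]
  linarith

theorem mul_datum_not_isStrongSolution {β M A r T : ℝ} {N : ℕ} (hβ : 1 / 4 < β)
    (hM : 6 + 4 * β < M) (hA : 2 ≤ A) (hN : 4 ≤ N) (hr : 0 < r) (hT : 0 < T)
    (f : ℝ → Wave → ℝ) : ¬ IsStrongSolution β M T (fun k => r * datum M A N k) f := by
  obtain ⟨c, η, hc, hη, hcollision⟩ := exists_collision_datum_le hβ.le hM
  obtain ⟨R₀, hR₀⟩ := hcollision A hA
  refine not_isStrongSolution hβ hM (c := r ^ 3 * (c * A ^ 2)) (by positivity)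
    ((measurable_datum M A N).const_mul r) (fun R => ?_) hT f
  refine (frequently_lt_norm_and_lt_cos (N := N) (by lia) hη (max R R₀)).mono fun k ⟨hk, hcos⟩ => ?_
  refine ⟨((le_max_left _ _).trans_lt hk).le, ?_⟩
  rw [collision_const_mul, abs_mul, abs_of_pos (by positivity), mul_assoc]
  gcongr
  exact le_abs.2 (Or.inr (le_neg.2 (hR₀ N k hN ((le_max_right _ _).trans_lt hk).le hcos.le)))

theorem exists_mul_rpow_le_abs_collision_datum {β M : ℝ} (hβ : 1 / 4 ≤ β) (hM : 6 + 4 * β < M) :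
    ∃ c : ℝ, 0 < c ∧ ∀ (A : ℝ) (N : ℕ), 2 ≤ A → 4 ≤ N → ∃ B₀ : ℕ, ∀ B : ℕ, B₀ ≤ B →
      ∀ k : Wave, ‖k‖ ^ 2 = 2 * π * B / N →
        c * A ^ 2 * (‖k‖ ^ 2) ^ (2 * β - 1 / 2 - M / 2) ≤ |collision β (datum M A N) k| := by
  obtain ⟨c, η, hc, hη, hcollision⟩ := exists_collision_datum_le hβ hM
  refine ⟨c, hc, fun A N hA hN => ?_⟩
  have hN₀ : (0 : ℝ) < N := by exact_mod_cast (by lia : 0 < N)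
  obtain ⟨R, hR⟩ := hcollision A hA
  obtain ⟨B₀, hB₀⟩ := exists_forall_le_norm_of_norm_sq_eq hN₀ R
  refine ⟨B₀, fun B hB k hk => ?_⟩
  have hcos := cos_mul_norm_sq_eq_one hN₀.ne' hk
  have hexponent : (‖k‖ ^ 2) ^ (2 * β - 1 / 2 - M / 2) = ‖k‖ ^ (4 * β - 1 - M) := by
    rw [← Real.rpow_two, ← Real.rpow_mul (norm_nonneg k)]
    ring_nf
  rw [hexponent]
  exact le_abs.2 (Or.inr (le_neg.2 (hR N k hN (hB₀ B hB k hk).le (by rw [hcos]; linarith))))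

end KineticWave

end

theorem mainTheorem3_general (β M : ℝ) (hβ : 1 / 4 < β) (hM : 6 + 4 * β < M) :
    (∀ δ : ℝ, 0 < δ → ∃ f₀ : KineticWave.Wave → ℝ,
      KineticWave.MemW M f₀ ∧ KineticWave.wNorm M f₀ = ENNReal.ofReal δ ∧
        ∀ T : ℝ, 0 < T → ¬ ∃ f : ℝ → KineticWave.Wave → ℝ,
          KineticWave.IsStrongSolution β M T f₀ f) ∧
    ∃ c : ℝ, 0 < c ∧ ∃ A₀ : ℝ, 0 < A₀ ∧ ∃ N₀ : ℕ, 0 < N₀ ∧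
      ∀ A : ℝ, A₀ ≤ A → ∀ N : ℕ, N₀ ≤ N →
        KineticWave.MemW M (KineticWave.datum M A N) ∧
        (∃ B₀ : ℕ, ∀ B : ℕ, B₀ ≤ B → ∀ k : KineticWave.Wave,
          ‖k‖ ^ 2 = 2 * Real.pi * B / N →
            c * A ^ 2 * (‖k‖ ^ 2) ^ (2 * β - 1 / 2 - M / 2) ≤
              |KineticWave.collision β (KineticWave.datum M A N) k|) ∧
        ∀ r : ℝ, 0 < r → ∀ T : ℝ, 0 < T → ¬ ∃ f : ℝ → KineticWave.Wave → ℝ,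
          KineticWave.IsStrongSolution β M T
            (fun k => r * KineticWave.datum M A N k) f := by
  have hM₀ : 0 ≤ M := by linarith
  have ill_posed {A : ℝ} {N : ℕ} (hA : 2 ≤ A) (hN : 4 ≤ N) (r : ℝ) (hr : 0 < r) (T : ℝ)
      (hT : 0 < T) : ¬ ∃ f : ℝ → KineticWave.Wave → ℝ,
        KineticWave.IsStrongSolution β M T (fun k => r * KineticWave.datum M A N k) f :=
    not_exists.2 (KineticWave.mul_datum_not_isStrongSolution hβ hM hA hN hr hT)
  obtain ⟨c, hc, hcollision⟩ := KineticWave.exists_mul_rpow_le_abs_collision_datum hβ.le hM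
  refine ⟨fun δ hδ => ?_, c, hc, 2, two_pos, 4, four_pos, fun A hA N hN =>
    ⟨KineticWave.memW_datum hM₀ hA N, hcollision A N hA hN, ill_posed hA hN⟩⟩
  have hmem : KineticWave.MemW M (KineticWave.datum M 2 4) := KineticWave.memW_datum hM₀ le_rfl 4
  obtain ⟨r, hr, hnorm⟩ :=
    hmem.exists_wNorm_const_mul_eq (KineticWave.wNorm_datum_ne_zero le_rfl 4) hδ
  exact ⟨_, hmem.const_mul r, hnorm, ill_posed le_rfl le_rfl r hr⟩

theorem mainTheorem3 (β M : ℝ) (hβ : 1 / 4 < β) (hβ' : β ≤ 1) (hM : 10 < M) :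
    -- ill-posedness, for data of every prescribed size
    (∀ δ : ℝ, 0 < δ → ∃ f₀ : KineticWave.Wave → ℝ,
      KineticWave.MemW M f₀ ∧ KineticWave.wNorm M f₀ = ENNReal.ofReal δ ∧
        ∀ T : ℝ, 0 < T → ¬ ∃ f : ℝ → KineticWave.Wave → ℝ,
          KineticWave.IsStrongSolution β M T f₀ f) ∧
    -- the explicit data, with the lower bound on the collision operator
    ∃ c : ℝ, 0 < c ∧ ∃ A₀ : ℝ, 0 < A₀ ∧ ∃ N₀ : ℕ, 0 < N₀ ∧
      ∀ A : ℝ, A₀ ≤ A → ∀ N : ℕ, N₀ ≤ N →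
        KineticWave.MemW M (KineticWave.datum M A N) ∧
        (∃ B₀ : ℕ, ∀ B : ℕ, B₀ ≤ B → ∀ k : KineticWave.Wave,
          ‖k‖ ^ 2 = 2 * Real.pi * B / N →
            c * A ^ 2 * (‖k‖ ^ 2) ^ (2 * β - 1 / 2 - M / 2) ≤
              |KineticWave.collision β (KineticWave.datum M A N) k|) ∧
        ∀ r : ℝ, 0 < r → ∀ T : ℝ, 0 < T → ¬ ∃ f : ℝ → KineticWave.Wave → ℝ,
          KineticWave.IsStrongSolution β M T
            (fun k => r * KineticWave.datum M A N k) f :=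
  mainTheorem3_general β M hβ (by linarith)
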